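/- **Definitions.** Let a group $G$ act on a compact metric space $X$ by homeomorphisms $\alpha_g$. For an open covering $\mathcal U$ of $X$ let $N(\mathcal U)$ be the minimal cardinality of a sub-covering, let $p^*_{\mathcal U}(n)=\max_{(g_1,\dots,g_n)\in G^n}N\big(\bigvee_{i=1}^n\alpha_{g_i^{-1}}(\mathcal U)\big)$, let $h^*(\mathcal U,G)=\lim_{n\to\infty}\frac1n\log p^*_{\mathcal U}(n)$, and let the maximal pattern entropy be $h^*(X,G)=\sup_{\mathcal U}h^*(\mathcal U,G)\in[0,\infty]$, the supremum being over all open coverings. If $H\le G$ acts on $X$ by $\alpha$ and $s:H\backslash G\to G$ is a section of the set of right cosets with $s(H)=e$, the co-induced action of $G$ on $X_H^G=\prod_{H\backslash G}X$ is $(\alpha^{H\backslash G}_{g_0}f)(Hg)=\alpha_{s(Hg)\,g_0\,s(Hgg_0)^{-1}}\big(f(Hgg_0)\big)$. **The Tan–Ye–Zhang system.** Embed the one-point compactification $A=\{a_i:i\in\mathbb Z\}\cup\{a_\infty\}$ of $\mathbb Z$ in the unit circle of $\mathbb R^2$. Choose non-negative integers $n^k_q$ ($k\ge1$, $0\le q\le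 k$) with $n_0^k=0$, $n_1^1=9$, $n^k_{q+1}>100\,n^k_q$ for $1\le q<k$, and $n_1^{k+1}>100\,n_k^k$. For $k\ge 1$ choose closed neighbourhoods $U^k(a_i)$ of $a_i$ ($i\in\mathbb Z\cup\{\infty\}$) in $\mathbb R^2$ such that $U^k(a_i)\cap U^k(a_j)=\emptyset$ for distinct $i,j\in\mathbb Z$; $U^k(a_i)\cap U^k(a_\infty)=\emptyset$ for $|i|\le n_k^k$; $U^k(a_i)\subseteq U^k(a_\infty)$ for $i\in\mathbb Z$ with $|i|>n^k_k$; $U^{k+1}(a_i)\subseteq U^k(a_i)$; and $\operatorname{diam}U^k(a_i)\le 1/k$. Let $F(k)=\{0,1\}^{\{0,\dots,k\}}$. For $s\in F(k)$ and $1\le q\le k$ choose $j^k_{s,q}\in\mathbb N$ with $\big|\frac{n^k_q-n^k_{q-1}}2-j^k_{s,q}\big|\le\frac k2$ and put $p^k_{s,q}=n^k_q-n^k_{q-1}-j^k_{s,q}-s(q)$. For $s\in F(k)$ choose distinct points $x_{s,i}\in\mathbb R^2$ ($i\in\mathbb Z$) such that for $1\le q\le k$ * $x_{s,n^k_{q-1}+i}\in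 U^k(a_{s(q-1)+i})$ for $0\le i<j^k_{s,q}$, * $x_{s,n^k_{q-1}+j^k_{s,q}+i}\in U^k(a_{-p^k_{s,q}+i})$ for $0\le i\le n^k_q-n^k_{q-1}-j^k_{s,q}$, and, for $r\ge1$, $x_{s,n^k_k+r}\in U^{k+r}(a_{s(k)+r})$ and $x_{s,-r}\in U^{k+r}(a_{s(0)-r})$; moreover no $x_{s,i}$ lies in $A$, and $x_{s,i}\ne x_{s',i'}$ for distinct words $s,s'\in\bigcup_kF(k)$. Let $X_s=\{x_{s,i}:i\in\mathbb Z\}\cup\{a_\infty\}$ and $X_1=\overline{\bigcup_{k\ge1}\bigcup_{s\in F(k)}X_s}$. **Theorem 3.11.** Such choices exist. For every such choice, $X_1$ is compact and contains $A$, and there is exactly one homeomorphism $T:X_1\to X_1$ with $T(a_i)=a_{i+1}$ for $i\in\mathbb Z$, $T(a_\infty)=a_\infty$ and $T(x_{s,i})=x_{s,i+1}$. Let $\mathbb Z$ act on $X_1$ by the powers of $T$, let $G=\mathbb Z\rtimes\mathbb Z/2\mathbb Z$ with the generator of $\mathbb Z/2\mathbb Z$ acting on $\mathbb Z$ by $n\mapsto-n$,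 and identify $\mathbb Z$ with the subgroup $\mathbb Z\times\{0\}$ of $G$, which has index $2$ and is not contained in the centre $Z(G)$. Then $h^*(X_1,\mathbb Z)=\log 2$ and, for the co-induced system (with any section), $$h^*\big((X_1)_{\mathbb Z}^G,G\big)=\log 2 .$$ In particular $h^*\big((X_1)_{\mathbb Z}^G,G\big)\ne[G:\mathbb Z]\,h^*(X_1,\mathbb Z)$. So the formula $h^*(X_H^G,G)=[G:H]\,h^*(X,H)$, which holds for subgroups $H\subseteq Z(G)$ of finite index, can fail for a subgroup of finite index that is not contained in $Z(G)$. -/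

import Mathlib

open Filter Topology

noncomputable section

/-! ### Maximal pattern entropy of a group acting by homeomorphisms -/

/-- `𝒰` is an open covering of `X`. -/
def IsOpenCovering {X : Type*} [TopologicalSpace X] (𝒰 : Set (Set X)) : Prop :=
  (∀ V ∈ 𝒰, IsOpen V) ∧ ⋃₀ 𝒰 = Set.univ

/-- `N(𝒰)`: the least cardinality of a sub-covering of `𝒰`. -/
def minSubcoverCard {X : Type*} (𝒰 : Set (Set X)) : ℕ∞ :=
  ⨅ 𝒲 ∈ {𝒲 : Set (Set X) | 𝒲 ⊆ 𝒰 ∧ ⋃₀ 𝒲 = Set.univ}, 𝒲.encard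

/-- The common refinement `⋁ᵢ α_{gᵢ⁻¹}(𝒰)`, that is, the family of all the intersections
`⋂ᵢ α_{gᵢ⁻¹}(Vᵢ)` with `Vᵢ ∈ 𝒰`. -/
def patternJoin {X G : Type*} [TopologicalSpace X] [Group G] (α : G →* (X ≃ₜ X))
    {n : ℕ} (g : Fin n → G) (𝒰 : Set (Set X)) : Set (Set X) :=
  {W | ∃ V : Fin n → Set X, (∀ i, V i ∈ 𝒰) ∧ W = ⋂ i, (α (g i)⁻¹) '' (V i)}

/-- `p*(n)`: the maximum of `N(⋁ᵢ α_{gᵢ⁻¹}(𝒰))` over all `(g₁, …, gₙ) ∈ Gⁿ`. -/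
def patternComplexity {X G : Type*} [TopologicalSpace X] [Group G] (α : G →* (X ≃ₜ X))
    (𝒰 : Set (Set X)) (n : ℕ) : ℕ∞ :=
  ⨆ g : Fin n → G, minSubcoverCard (patternJoin α g 𝒰)

/-- The maximal pattern entropy with respect to `𝒰`, the limit of `(1/n) log p*(n)`.
The sequence `log p*(n)` is sub-additive, so this limit exists for every open covering of a
non-empty compact space and is equal to the upper limit written here. -/
def maxPatternEntropyOf {X G : Type*} [TopologicalSpace X] [Group G] (α : G →* (X ≃ₜ X))
    (𝒰 : Set (Set X)) : EReal :=
  limsup (fun n : ℕ => ENNReal.log (patternComplexity α 𝒰 n : ENNReal) / (n : EReal)) atTop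

/-- The maximal pattern entropy `h*(X, G, α)`: the supremum over all open coverings. -/
def maxPatternEntropy {X G : Type*} [TopologicalSpace X] [Group G] (α : G →* (X ≃ₜ X)) :
    EReal :=
  ⨆ 𝒰 ∈ {𝒰 : Set (Set X) | IsOpenCovering 𝒰}, maxPatternEntropyOf α 𝒰

/-! ### Co-induction -/

/-- The set `H\G` of right cosets `Hg`. -/
abbrev RightCosets {G : Type*} [Group G] (H : Subgroup G) : Type _ :=
  Quotient (QuotientGroup.rightRel H)

/-- The right coset `Hg`. -/
abbrev rightCoset {G : Type*} [Group G] (H : Subgroup G) (g : G) : RightCosets H :=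
  Quotient.mk (QuotientGroup.rightRel H) g

theorem rightCosets_mk_eq_iff {G : Type*} [Group G] {H : Subgroup G} {a b : G} :
    rightCoset H a = rightCoset H b ↔ a * b⁻¹ ∈ H := by
  rw [Quotient.eq, QuotientGroup.rightRel_apply]
  rw [← H.inv_mem_iff]
  simp

/-- A section `s : H\G → G` of the quotient map with `s(H) = e`. -/
structure CosetSection {G : Type*} [Group G] (H : Subgroup G) where
  /-- the underlying function -/
  toFun : RightCosets H → G
  mk_toFun : ∀ θ, rightCoset H (toFun θ) = θ
  toFun_one : toFun (rightCoset H 1) = 1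

namespace CosetSection

variable {G : Type*} [Group G] {H : Subgroup G} (s : CosetSection H)

/-- For `θ = Hg` the coset `Hgg₀`. -/
def shift (θ : RightCosets H) (g₀ : G) : RightCosets H :=
  rightCoset H (s.toFun θ * g₀)

theorem shift_rightCoset (g g₀ : G) : s.shift (rightCoset H g) g₀ = rightCoset H (g * g₀) := by
  unfold shift
  have h := rightCosets_mk_eq_iff.1 (s.mk_toFun (rightCoset H g))
  rw [rightCosets_mk_eq_iff]
  simpa [mul_assoc] using h

theorem shift_one (θ : RightCosets H) : s.shift θ 1 = θ := by
  simp [shift, s.mk_toFun]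

theorem shift_shift (θ : RightCosets H) (g g' : G) :
    s.shift (s.shift θ g) g' = s.shift θ (g * g') := by
  rw [shift.eq_def s θ g, shift_rightCoset, shift.eq_def, mul_assoc]

/-- The element `s(Hg) g₀ s(Hgg₀)⁻¹` of `H`. -/
def cocycle (θ : RightCosets H) (g₀ : G) : H :=
  ⟨s.toFun θ * g₀ * (s.toFun (s.shift θ g₀))⁻¹,
    rightCosets_mk_eq_iff.1 (s.mk_toFun (s.shift θ g₀)).symm⟩

theorem cocycle_one (θ : RightCosets H) : s.cocycle θ 1 = 1 := by
  apply Subtype.ext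
  simp [cocycle, shift_one]

theorem cocycle_mul (θ : RightCosets H) (g g' : G) :
    s.cocycle θ (g * g') = s.cocycle θ g * s.cocycle (s.shift θ g) g' := by
  apply Subtype.ext
  simp [cocycle, shift_shift, mul_assoc]

end CosetSection

/-- The homeomorphism `α^{H\G,s}_{g₀}` of `∏_{H\G} X`:
`(α^{H\G,s}_{g₀} f)(Hg) = α_{s(Hg) g₀ s(Hgg₀)⁻¹} (f (Hgg₀))`. -/
def coinducedHomeomorph {X G : Type*} [TopologicalSpace X] [Group G] {H : Subgroup G}
    (α : H →* (X ≃ₜ X)) (s : CosetSection H) (g₀ : G) :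
    (RightCosets H → X) ≃ₜ (RightCosets H → X) where
  toFun f θ := α (s.cocycle θ g₀) (f (s.shift θ g₀))
  invFun f θ := α (s.cocycle θ g₀⁻¹) (f (s.shift θ g₀⁻¹))
  left_inv f := by
    funext θ
    have h := s.cocycle_mul θ g₀⁻¹ g₀
    rw [inv_mul_cancel, s.cocycle_one] at h
    change (α _ * α _) (f _) = f θ
    rw [← map_mul, ← h, s.shift_shift, inv_mul_cancel, s.shift_one, map_one]
    rfl
  right_inv f := by
    funext θ
    have h := s.cocycle_mul θ g₀ g₀⁻¹
    rw [mul_inv_cancel, s.cocycle_one] at h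
    change (α _ * α _) (f _) = f θ
    rw [← map_mul, ← h, s.shift_shift, mul_inv_cancel, s.shift_one, map_one]
    rfl
  continuous_toFun :=
    continuous_pi fun θ => (α (s.cocycle θ g₀)).continuous.comp (continuous_apply _)
  continuous_invFun :=
    continuous_pi fun θ => (α (s.cocycle θ g₀⁻¹)).continuous.comp (continuous_apply _)

/-- The co-induced action `α^{H\G,s}` of `G` on `∏_{H\G} X`. -/
def coinduced {X G : Type*} [TopologicalSpace X] [Group G] {H : Subgroup G}
    (α : H →* (X ≃ₜ X)) (s : CosetSection H) :
    G →* ((RightCosets H → X) ≃ₜ (RightCosets H → X)) where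
  toFun := coinducedHomeomorph α s
  map_one' := by
    ext f θ
    change α (s.cocycle θ 1) (f (s.shift θ 1)) = f θ
    rw [s.cocycle_one, s.shift_one, map_one]
    rfl
  map_mul' g g' := by
    ext f θ
    change α (s.cocycle θ (g * g')) (f (s.shift θ (g * g')))
      = (α (s.cocycle θ g) * α (s.cocycle (s.shift θ g) g'))
          (f (s.shift (s.shift θ g) g'))
    rw [s.cocycle_mul, s.shift_shift, map_mul]

/-! ### The group `ℤ ⋊ ℤ/2ℤ` -/

/-- The homomorphism `ℤ/2ℤ → Aut(ℤ)` whose value at the generator is `n ↦ -n`. -/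
def inversionHom : Multiplicative (ZMod 2) →* MulAut (Multiplicative ℤ) where
  toFun i := if i = 1 then 1 else MulEquiv.inv (Multiplicative ℤ)
  map_one' := by simp
  map_mul' := by
    have key : MulEquiv.inv (Multiplicative ℤ) * MulEquiv.inv (Multiplicative ℤ)
        = (1 : MulAut (Multiplicative ℤ)) := by
      ext n
      simp
    have cases2 : ∀ i : Multiplicative (ZMod 2), i = 1 ∨ i = Multiplicative.ofAdd 1 := by
      decide
    have hne : (Multiplicative.ofAdd 1 : Multiplicative (ZMod 2)) ≠ 1 := by decide
    have hsq : (Multiplicative.ofAdd 1 * Multiplicative.ofAdd 1 : Multiplicative (ZMod 2)) = 1 := by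
      decide
    intro i j
    rcases cases2 i with rfl | rfl <;> rcases cases2 j with rfl | rfl <;>
      simp [hne, hsq, key]

/-- The group `ℤ ⋊ ℤ/2ℤ`, with `ℤ/2ℤ` acting on `ℤ` by inversion. -/
abbrev ZInvZ2 : Type := Multiplicative ℤ ⋊[inversionHom] Multiplicative (ZMod 2)

/-- The copy `ℤ × {0}` of `ℤ` inside `ℤ ⋊ ℤ/2ℤ`. -/
def ZInvZ2.intSubgroup : Subgroup ZInvZ2 :=
  (SemidirectProduct.inl : Multiplicative ℤ →* ZInvZ2).range

/-- The identification of `ℤ` with `ℤ × {0}`. -/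
def ZInvZ2.intEquiv : Multiplicative ℤ ≃* ZInvZ2.intSubgroup :=
  MonoidHom.ofInjective SemidirectProduct.inl_injective

/-- The action `n ↦ Tⁿ` of `ℤ` generated by a homeomorphism `T`. -/
def zAction {X : Type*} [TopologicalSpace X] (T : X ≃ₜ X) : Multiplicative ℤ →* (X ≃ₜ X) :=
  zpowersHom (X ≃ₜ X) T

/-- The same action, as an action of the subgroup `ℤ × {0}` of `ℤ ⋊ ℤ/2ℤ`. -/
def intSubgroupAction {X : Type*} [TopologicalSpace X] (T : X ≃ₜ X) :
    ZInvZ2.intSubgroup →* (X ≃ₜ X) :=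
  (zAction T).comp ZInvZ2.intEquiv.symm.toMonoidHom

/-! ### The Tan–Ye–Zhang system -/

/-- The plane `ℝ²`. -/
abbrev Plane : Type := EuclideanSpace ℝ (Fin 2)

/-- `F(k)`: the set of words `s : {0, …, k} → {0, 1}`. -/
abbrev BinWord (k : ℕ) : Type := Fin (k + 1) → Fin 2

/-- A complete list of the choices that are made in the construction of the Tan–Ye–Zhang system,
with the constraints under which they are made. Only the levels `k ≥ 1` matter, and only the
numbers `n k q` with `q ≤ k`. An index `q : Fin k` stands for the number `q + 1` of `{1, …, k}`:
then `q.succ` and `q.castSucc` are the positions `q + 1` and `q` of `{0, …, k}`. -/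
structure TanYeZhangChoice where
  /-- the embedding of the one-point compactification of `ℤ` (the points `a_i` and `a_∞`) -/
  a : OnePoint ℤ → Plane
  a_embedding : IsEmbedding a
  a_circle : ∀ z, a z ∈ Metric.sphere (0 : Plane) 1
  /-- the numbers `n_q^k` -/
  n : ℕ → ℕ → ℕ
  n_zero : ∀ k, 1 ≤ k → n k 0 = 0
  n_one_one : n 1 1 = 9
  n_step : ∀ k, 1 ≤ k → ∀ q, 1 ≤ q → q < k → 100 * n k q < n k (q + 1)
  n_next : ∀ k, 1 ≤ k → 100 * n k k < n (k + 1) 1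
  /-- the closed neighbourhoods `U^k(a_i)`, `U^k(a_∞)` -/
  U : ℕ → OnePoint ℤ → Set Plane
  U_closed : ∀ k, 1 ≤ k → ∀ z, IsClosed (U k z)
  U_nhds : ∀ k, 1 ≤ k → ∀ z, U k z ∈ 𝓝 (a z)
  U_disjoint : ∀ k, 1 ≤ k → ∀ i j : ℤ, i ≠ j →
    Disjoint (U k (i : OnePoint ℤ)) (U k (j : OnePoint ℤ))
  U_disjoint_infty : ∀ k, 1 ≤ k → ∀ i : ℤ, |i| ≤ (n k k : ℤ) →
    Disjoint (U k (i : OnePoint ℤ)) (U k OnePoint.infty)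
  U_subset_infty : ∀ k, 1 ≤ k → ∀ i : ℤ, (n k k : ℤ) < |i| →
    U k (i : OnePoint ℤ) ⊆ U k OnePoint.infty
  U_anti : ∀ k, 1 ≤ k → ∀ z, U (k + 1) z ⊆ U k z
  /-- `diam U^k(z) ≤ 1/k` -/
  U_diam : ∀ k, 1 ≤ k → ∀ z, ∀ p ∈ U k z, ∀ p' ∈ U k z, dist p p' ≤ 1 / (k : ℝ)
  /-- the jump numbers `j_{s,q}^k` -/
  jump : (k : ℕ) → BinWord k → Fin k → ℕ
  jump_near : ∀ k, 1 ≤ k → ∀ (s : BinWord k) (q : Fin k),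
    |((n k (q + 1) : ℝ) - (n k q : ℝ)) / 2 - (jump k s q : ℝ)| ≤ (k : ℝ) / 2
  /-- the points `x_{s,i}` -/
  x : (k : ℕ) → BinWord k → ℤ → Plane
  /-- before the jump: `x_{s, n_{q-1} + i} ∈ U^k(a_{s(q-1) + i})` for `0 ≤ i < j_{s,q}` -/
  x_before : ∀ k, 1 ≤ k → ∀ (s : BinWord k) (q : Fin k) (i : ℕ), i < jump k s q →
    x k s ((n k q : ℤ) + i) ∈ U k ((((s q.castSucc : ℕ) : ℤ) + i : ℤ) : OnePoint ℤ)
  /-- after the jump: `x_{s, n_{q-1} + j_{s,q} + i} ∈ U^k(a_{-p_{s,q} + i})` for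
  `0 ≤ i ≤ n_q - n_{q-1} - j_{s,q}`, where `p_{s,q} = n_q - n_{q-1} - j_{s,q} - s(q)` -/
  x_after : ∀ k, 1 ≤ k → ∀ (s : BinWord k) (q : Fin k) (i : ℕ),
    n k q + jump k s q + i ≤ n k (q + 1) →
    x k s ((n k q : ℤ) + jump k s q + i) ∈
      U k ((-((n k (q + 1) : ℤ) - n k q - jump k s q - ((s q.succ : ℕ) : ℤ)) + i : ℤ) :
        OnePoint ℤ)
  /-- the forward tail: `x_{s, n_k + r} ∈ U^{k+r}(a_{s(k) + r})` for `r ≥ 1` -/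
  x_forward : ∀ k, 1 ≤ k → ∀ (s : BinWord k) (r : ℕ), 1 ≤ r →
    x k s ((n k k : ℤ) + r) ∈ U (k + r) ((((s (Fin.last k) : ℕ) : ℤ) + r : ℤ) : OnePoint ℤ)
  /-- the backward tail: `x_{s, -r} ∈ U^{k+r}(a_{s(0) - r})` for `r ≥ 1` -/
  x_backward : ∀ k, 1 ≤ k → ∀ (s : BinWord k) (r : ℕ), 1 ≤ r →
    x k s (-(r : ℤ)) ∈ U (k + r) ((((s 0 : ℕ) : ℤ) - r : ℤ) : OnePoint ℤ)
  x_injective : ∀ k, 1 ≤ k → ∀ s : BinWord k, Function.Injective (x k s)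
  /-- `X_s ∩ A = {a_∞}` -/
  x_not_mem : ∀ k, 1 ≤ k → ∀ (s : BinWord k) (i : ℤ), x k s i ∉ Set.range a
  /-- `X_s ∩ X_{s'} = {a_∞}` for distinct words `s`, `s'`, of the same or of different levels -/
  x_disjoint : ∀ w w' : (Σ k : ℕ, BinWord k), 1 ≤ w.1 → 1 ≤ w'.1 → w ≠ w' →
    Disjoint (Set.range (x w.1 w.2)) (Set.range (x w'.1 w'.2))

namespace TanYeZhangChoice

variable (D : TanYeZhangChoice)

/-- `X_s = {x_{s,i} : i ∈ ℤ} ∪ {a_∞}`. -/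
def orbitClosure (k : ℕ) (s : BinWord k) : Set Plane :=
  Set.range (D.x k s) ∪ {D.a OnePoint.infty}

/-- `X₁`, the closure of the union of all the `X_s`. -/
def X₁ : Set Plane :=
  closure (⋃ k : ℕ, ⋃ _ : 1 ≤ k, ⋃ s : BinWord k, D.orbitClosure k s)

/-- The rule for `T`: `T a_i = a_{i+1}`, `T a_∞ = a_∞`, `T x_{s,i} = x_{s,i+1}`. -/
def IsShift (T : D.X₁ ≃ₜ D.X₁) : Prop :=
  ∀ y : D.X₁,
    (∀ i : ℤ, (y : Plane) = D.a (i : OnePoint ℤ) → (T y : Plane) = D.a ((i + 1 : ℤ) : OnePoint ℤ)) ∧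
    ((y : Plane) = D.a OnePoint.infty → (T y : Plane) = D.a OnePoint.infty) ∧
    (∀ k, 1 ≤ k → ∀ (s : BinWord k) (i : ℤ),
      (y : Plane) = D.x k s i → (T y : Plane) = D.x k s (i + 1))

end TanYeZhangChoice

end

/-!
# A co-induced system with the same maximal pattern entropy

**Why the statement is true.** The orbit of a word `s ∈ F(k)` is near the point `a_{s(q)}` at the
time `n_q`, called a *mark* below, for `q = 0, …, k`. In between it runs out along `A` towards `a_∞`
and jumps from one end of `A` to the other. So a window around the finite part of `A` is seen by
the orbit only near the marks, where the position is given by the letter `s(q)`.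

*Lower bound.* All the words of length `k + 1` occur, so that the sets `U¹(a_0)` and `U¹(a_1)` are
independent along the `k + 1` times `n_0, …, n_k`. This gives entropy at least `log 2`
(`log_two_le_maxPatternEntropy`), for the system and, through a coordinate, for the co-induced one.

*Upper bound.* By a Lebesgue number argument it is enough to count patterns of codes, where a point
is coded by its anchor (the index of the point of `A` which it follows) if that lies in a window
`[-L, L]`, and finitely many points are coded by themselves (`exists_isCoding`,
`minSubcoverCard_patternJoin_le`). At `n` given times the points of `A`, the orbits of low level,
and those orbits of high level which are seen near one mark at most have `O(n)` patterns altogether.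
An orbit seen near two marks is determined, up to its word, by the two times and bounded errors: the
marks of all levels together are lacunary with ratio `100`, so that the difference of two marks
determines the larger one. That leaves `O(n²)` families, each with one bit for each visited mark
(`exists_families`). An orbit visits at most `n` marks, whence entropy at most `log 2`.

*The co-induced system.* Conjugation by an element outside `ℤ` inverts `ℤ`, so that the group acts
on `X₁ × X₁` by the maps `Tᵗ × T⁻ᵗ`, up to interchanging the coordinates (`coinduced_cases`). If an
orbit followed forwards and an orbit followed backwards are near the marks `m` and `m'` at the same
time, the sum `m + m'` is known up to a bounded error, and by lacunarity this happens for at most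
two pairs of marks. So the two orbits together visit at most `n + 2` marks at `n` times
(`card_visited_add_card_visited_neg_le`), and the pairs of patterns are still at most
`O(n⁴) 2ⁿ` in number. With commuting time directions, `T × T`, all the marks would be visited twice
and the entropy would double; here it does not.

For the topology, `X₁` is `A` together with the points `x_{s,i}`, because these points come close to
their anchors, with finitely many exceptions for each distance, and so accumulate at `A` only. The
shift is continuous because the orbits jump far away from the finite part of `A`
(`tendsto_pos_shift_one`).
-/

noncomputable section

/-! ### Bounding the maximal pattern entropy by counting and by independence -/

/-- Counting upper bound: if a map `κ` on `Y` is so fine that the points with the same value of `κ`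
are carried into a common element of `𝒰` by each `g i`, then the join has a sub-covering with at
most as many elements as `κ` has values. -/
theorem minSubcoverCard_patternJoin_le {Y G B : Type*} [TopologicalSpace Y] [Group G]
    (α : G →* (Y ≃ₜ Y)) {n : ℕ} (g : Fin n → G) (𝒰 : Set (Set Y)) (κ : Y → B)
    (hκ : ∀ y i, ∃ V ∈ 𝒰, ∀ y', κ y' = κ y → α (g i) y' ∈ V) :
    minSubcoverCard (patternJoin α g 𝒰) ≤ (Set.range κ).encard := by
  choose V hV hmem using hκ
  have himg : ∀ (i : Fin n) (S : Set Y) (y : Y), y ∈ (α (g i)⁻¹) '' S ↔ α (g i) y ∈ S := by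
    intro i S y
    rw [map_inv]
    constructor
    · rintro ⟨z, hz, rfl⟩
      have : α (g i) ((α (g i))⁻¹ z) = z := (α (g i)).apply_symm_apply z
      rwa [this]
    · intro h
      exact ⟨_, h, (α (g i)).symm_apply_apply y⟩
  let rep : Set.range κ → Y := fun b => b.2.choose
  have hrep : ∀ b : Set.range κ, κ (rep b) = b := fun b => b.2.choose_spec
  -- one element of the join for each value of `κ`, chosen by means of a representative
  let 𝒲 : Set (Set Y) := Set.range fun b : Set.range κ => ⋂ i, (α (g i)⁻¹) '' V (rep b) i
  have hle : 𝒲.encard ≤ (Set.range κ).encard := by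
    calc 𝒲.encard = ((fun b : Set.range κ => ⋂ i, (α (g i)⁻¹) '' V (rep b) i) ''
          Set.univ).encard := by rw [Set.image_univ]
      _ ≤ (Set.univ : Set (Set.range κ)).encard := Set.encard_image_le _ _
      _ = (Set.range κ).encard := by rw [Set.encard_univ]; rfl
  refine le_trans (iInf₂_le 𝒲 ⟨?_, ?_⟩) hle
  · rintro _ ⟨b, rfl⟩
    exact ⟨_, fun i => hV _ _, rfl⟩
  · rw [Set.eq_univ_iff_forall]
    intro y
    refine ⟨_, ⟨⟨κ y, y, rfl⟩, rfl⟩, ?_⟩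
    rw [Set.mem_iInter]
    intro i
    rw [himg]
    exact hmem _ _ _ (hrep ⟨κ y, y, rfl⟩).symm

/-- The logarithmic growth rate of a polynomial times `2 ^ n` is `log 2`. -/
theorem tendsto_log_poly_mul_two_pow (C : ℕ) (hC : 0 < C) (d : ℕ) :
    Tendsto (fun n : ℕ => Real.log ((C * (n + 1) ^ d * 2 ^ n : ℕ) : ℝ) / n) atTop
      (𝓝 (Real.log 2)) := by
  have h1 : Tendsto (fun n : ℕ => Real.log C / (n : ℝ)) atTop (𝓝 0) :=
    tendsto_const_div_atTop_nhds_zero_nat _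
  have h2 : Tendsto (fun n : ℕ => Real.log ((n : ℝ) + 1) / (n : ℝ)) atTop (𝓝 0) := by
    have ha : Tendsto (fun n : ℕ => Real.log ((n + 1 : ℕ) : ℝ) / ((n + 1 : ℕ) : ℝ)) atTop (𝓝 0) :=
      (Real.isLittleO_log_id_atTop.tendsto_div_nhds_zero.comp
        tendsto_natCast_atTop_atTop).comp (tendsto_add_atTop_nat 1)
    have hb : Tendsto (fun n : ℕ => 1 + 1 / (n : ℝ)) atTop (𝓝 (1 + 0)) :=
      tendsto_const_nhds.add tendsto_one_div_atTop_nhds_zero_nat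
    have hc := ha.mul hb
    rw [zero_mul] at hc
    refine hc.congr' ?_
    filter_upwards [eventually_gt_atTop 0] with n hn
    have : (n : ℝ) ≠ 0 := by positivity
    have h' : (n : ℝ) + 1 ≠ 0 := by positivity
    push_cast
    field_simp
  have h3 : Tendsto (fun n : ℕ => Real.log C / (n : ℝ) + d * (Real.log ((n : ℝ) + 1) / (n : ℝ))
      + Real.log 2) atTop (𝓝 (0 + d * 0 + Real.log 2)) :=
    (h1.add (h2.const_mul _)).add tendsto_const_nhds
  rw [mul_zero, zero_add, zero_add] at h3
  refine h3.congr' ?_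
  filter_upwards [eventually_gt_atTop 0] with n hn
  have hn' : (n : ℝ) ≠ 0 := by positivity
  have hC' : (C : ℝ) ≠ 0 := by positivity
  push_cast
  rw [Real.log_mul (by positivity) (by positivity), Real.log_mul hC' (by positivity),
    Real.log_pow, Real.log_pow]
  field_simp

theorem ennreal_log_natCast_div {m : ℕ} (hm : 0 < m) (n : ℕ) :
    ENNReal.log (((m : ℕ∞) : ENNReal)) / (n : EReal) = ((Real.log m / n : ℝ) : EReal) := by
  have h : ((m : ℕ∞) : ENNReal) = ENNReal.ofReal (m : ℝ) := by simp
  rw [h, ENNReal.log_ofReal_of_pos (by exact_mod_cast hm), EReal.coe_div]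
  simp

theorem maxPatternEntropyOf_le_log_two {Y G : Type*} [TopologicalSpace Y] [Group G]
    (α : G →* (Y ≃ₜ Y)) (𝒰 : Set (Set Y)) (C d : ℕ)
    (h : ∀ n (g : Fin n → G),
      minSubcoverCard (patternJoin α g 𝒰) ≤ ((C * (n + 1) ^ d * 2 ^ n : ℕ) : ℕ∞)) :
    maxPatternEntropyOf α 𝒰 ≤ ((Real.log 2 : ℝ) : EReal) := by
  have hlim : Tendsto (fun n : ℕ =>
      ((Real.log (((C + 1) * (n + 1) ^ d * 2 ^ n : ℕ) : ℝ) / n : ℝ) : EReal)) atTop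
      (𝓝 ((Real.log 2 : ℝ) : EReal)) :=
    (continuous_coe_real_ereal.tendsto _).comp
      (tendsto_log_poly_mul_two_pow (C + 1) (Nat.succ_pos _) d)
  rw [maxPatternEntropyOf, ← hlim.limsup_eq]
  refine limsup_le_limsup (Eventually.of_forall fun n => ?_)
  have hpos : 0 < (C + 1) * (n + 1) ^ d * 2 ^ n := by positivity
  beta_reduce
  rw [← ennreal_log_natCast_div hpos]
  refine EReal.div_le_div_right_of_nonneg (by positivity) (ENNReal.log_monotone ?_)
  rw [ENat.toENNReal_le]
  refine iSup_le fun g => (h n g).trans ?_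
  exact_mod_cast Nat.mul_le_mul_right _ (Nat.mul_le_mul_right _ (Nat.le_succ C))

/-- Independence lower bound: if for every `k ≥ 1` there are `k + 1` group elements along which
every itinerary through two disjoint closed sets `B 0`, `B 1` is realised by some point, then the
maximal pattern entropy is at least `log 2`. -/
theorem log_two_le_maxPatternEntropy {Y G : Type*} [TopologicalSpace Y] [Group G]
    (α : G →* (Y ≃ₜ Y)) (B : Fin 2 → Set Y) (hB : ∀ b, IsClosed (B b))
    (hdisj : Disjoint (B 0) (B 1))
    (h : ∀ k, 1 ≤ k → ∃ g : Fin (k + 1) → G, ∀ s : Fin (k + 1) → Fin 2, ∃ y, ∀ q,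
      α (g q) y ∈ B (s q)) :
    ((Real.log 2 : ℝ) : EReal) ≤ maxPatternEntropy α := by
  let 𝒰 : Set (Set Y) := Set.range fun b => (B b)ᶜ
  have hcov : IsOpenCovering 𝒰 := by
    refine ⟨?_, ?_⟩
    · rintro _ ⟨b, rfl⟩
      exact (hB b).isOpen_compl
    · rw [Set.eq_univ_iff_forall]
      intro y
      by_cases hy : y ∈ B 0
      · exact ⟨_, ⟨1, rfl⟩, Set.disjoint_left.1 hdisj hy⟩
      · exact ⟨_, ⟨0, rfl⟩, hy⟩
  refine le_trans ?_ (le_iSup₂ (f := fun 𝒰 _ => maxPatternEntropyOf α 𝒰) 𝒰 hcov)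
  have hcard : ∀ k, 1 ≤ k → ((2 ^ (k + 1) : ℕ) : ℕ∞) ≤ patternComplexity α 𝒰 (k + 1) := by
    intro k hk
    obtain ⟨g, hg⟩ := h k hk
    refine le_trans ?_ (le_iSup _ g)
    refine le_iInf₂ fun 𝒲 h𝒲 => ?_
    choose y hy using hg
    have hex : ∀ s, ∃ W ∈ 𝒲, y s ∈ W := fun s => by
      have : y s ∈ ⋃₀ 𝒲 := h𝒲.2 ▸ Set.mem_univ _
      exact this
    choose W hW hyW using hex
    -- an element of the join misses, at each time, one of the two sets, and so contains at most
    -- one of the points `y s`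
    have hinj : Function.Injective W := by
      intro s s' hss
      obtain ⟨V, hV, hWV⟩ := h𝒲.1 (hW s)
      have key : ∀ s'', y s'' ∈ W s → ∀ q, α (g q) (y s'') ∈ V q := by
        intro s'' hs'' q
        rw [hWV] at hs''
        obtain ⟨z, hz, hzy⟩ := Set.mem_iInter.1 hs'' q
        rw [← hzy, map_inv]
        have : α (g q) ((α (g q))⁻¹ z) = z := (α (g q)).apply_symm_apply z
        rwa [this]
      funext q
      obtain ⟨b, hb⟩ := hV q
      have h1 := key s (hyW s) q
      have h2 := key s' (hss ▸ hyW s') q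
      have e1 : s q ≠ b := by
        rintro rfl
        rw [← hb] at h1
        exact h1 (hy s q)
      have e2 : s' q ≠ b := by
        rintro rfl
        rw [← hb] at h2
        exact h2 (hy s' q)
      omega
    calc ((2 ^ (k + 1) : ℕ) : ℕ∞) = (Set.univ : Set (Fin (k + 1) → Fin 2)).encard := by
          rw [Set.encard_univ, ENat.card_eq_coe_fintype_card]; simp
      _ = (Set.range W).encard := by rw [← Set.image_univ, hinj.encard_image]
      _ ≤ 𝒲.encard := Set.encard_le_encard (Set.range_subset_iff.2 hW)
  refine le_limsup_of_frequently_le (Eventually.frequently ?_)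
  filter_upwards [eventually_ge_atTop 2] with n hn
  obtain ⟨k, rfl⟩ : ∃ k, n = k + 1 := ⟨n - 1, by omega⟩
  have e : ((Real.log 2 : ℝ) : EReal)
      = ENNReal.log ((((2 ^ (k + 1) : ℕ) : ℕ∞)) : ENNReal) / ((k + 1 : ℕ) : EReal) := by
    rw [ennreal_log_natCast_div (by positivity)]
    congr 1
    push_cast
    rw [Real.log_pow]
    push_cast
    field_simp
  rw [e]
  refine EReal.div_le_div_right_of_nonneg (by positivity) (ENNReal.log_monotone ?_)
  rw [ENat.toENNReal_le]
  exact hcard k (by omega)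

/-! ### Marks and anchors -/

/-- The letter `s(q)` as a natural number, with the junk value `0` for `q > k`. -/
def BinWord.letter {k : ℕ} (s : BinWord k) (q : ℕ) : ℕ :=
  if h : q < k + 1 then (s ⟨q, h⟩ : ℕ) else 0

theorem BinWord.letter_le_one {k : ℕ} (s : BinWord k) (q : ℕ) : s.letter q ≤ 1 := by
  unfold BinWord.letter
  split_ifs <;> omega

theorem BinWord.letter_val {k : ℕ} (s : BinWord k) (q : Fin (k + 1)) : s.letter q = (s q : ℕ) := by
  unfold BinWord.letter
  rw [dif_pos q.is_lt]

/-- The number of the marks `ν 0 < ν 1 < ⋯ < ν k` that is current at time `u`: the number of the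
jump times `ν r + J r` up to `u`. -/
def markIndex {k : ℕ} (ν : ℕ → ℕ) (J : Fin k → ℕ) (u : ℤ) : ℕ :=
  (Finset.univ.filter fun r : Fin k => (ν r + J r : ℤ) ≤ u).card

/-- The index of the point of `A` which the orbit of the word `s` follows at time `u`. -/
def anchorIndex {k : ℕ} (ν : ℕ → ℕ) (J : Fin k → ℕ) (s : BinWord k) (u : ℤ) : ℤ :=
  u - ν (markIndex ν J u) + s.letter (markIndex ν J u)

/-- The level of the neighbourhood of the anchor in which the point at time `u` of an orbit of
level `k` lies. -/
def anchorLevel (k : ℕ) (ν : ℕ → ℕ) (u : ℤ) : ℕ :=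
  k + (-u).toNat + (u - ν k).toNat

/-- Each jump takes place after the current mark and not after the next one. -/
def JumpsInterlace {k : ℕ} (ν : ℕ → ℕ) (J : Fin k → ℕ) : Prop :=
  ∀ r : Fin k, 0 < J r ∧ ν r + J r ≤ ν (r + 1)

theorem markIndex_le {k : ℕ} (ν : ℕ → ℕ) (J : Fin k → ℕ) (u : ℤ) : markIndex ν J u ≤ k :=
  (Finset.card_filter_le _ _).trans (by simp)

theorem markIndex_eq_of_iff {k : ℕ} {ν : ℕ → ℕ} {J : Fin k → ℕ} {u : ℤ} {m : ℕ} (hm : m ≤ k)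
    (h : ∀ r : Fin k, (ν r + J r : ℤ) ≤ u ↔ (r : ℕ) < m) : markIndex ν J u = m := by
  unfold markIndex
  simp_rw [h]
  rw [Fin.card_filter_val_lt]
  exact min_eq_right hm

namespace JumpsInterlace

variable {k : ℕ} {ν : ℕ → ℕ} {J : Fin k → ℕ}

theorem mono (hJ : JumpsInterlace ν J) {a b : ℕ} (hab : a ≤ b) (hb : b ≤ k) : ν a ≤ ν b := by
  induction b, hab using Nat.le_induction with
  | base => exact le_rfl
  | succ b _ ih =>
    have := hJ ⟨b, hb⟩
    have := ih (by omega)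
    simp only at *
    omega

theorem jump_lt_jump (hJ : JumpsInterlace ν J) {r r' : Fin k} (h : r < r') :
    ν r + J r < ν r' + J r' := by
  have h1 := hJ r
  have h2 := hJ r'
  have h3 := hJ.mono (a := r + 1) (b := r') h r'.is_lt.le
  omega

theorem markIndex_eq (hJ : JumpsInterlace ν J) {u : ℤ} {m : ℕ} (hm : m ≤ k)
    (h1 : ∀ r : Fin k, (r : ℕ) + 1 = m → (ν r + J r : ℤ) ≤ u)
    (h2 : ∀ r : Fin k, (r : ℕ) = m → u < (ν r + J r : ℤ)) : markIndex ν J u = m := by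
  refine markIndex_eq_of_iff hm fun r => ⟨fun h => ?_, fun h => ?_⟩
  · by_contra! hr
    have h3 := h2 ⟨m, by omega⟩ rfl
    rcases hr.eq_or_lt with e | e
    · have : r = ⟨m, by omega⟩ := Fin.ext e.symm
      rw [← this] at h3
      omega
    · have := hJ.jump_lt_jump (r := ⟨m, by omega⟩) (r' := r) e
      omega
  · have h3 := h1 ⟨m - 1, by omega⟩ (by simp only; omega)
    rcases (show (r : ℕ) ≤ m - 1 by omega).eq_or_lt with e | e
    · have : r = ⟨m - 1, by omega⟩ := Fin.ext e
      rwa [← this] at h3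
    · have := hJ.jump_lt_jump (r := r) (r' := ⟨m - 1, by omega⟩) e
      omega

theorem jump_le_iff (hJ : JumpsInterlace ν J) (u : ℤ) (r : Fin k) :
    (ν r + J r : ℤ) ≤ u ↔ (r : ℕ) < markIndex ν J u := by
  have key : ∃ m ≤ k, ∀ r : Fin k, (ν r + J r : ℤ) ≤ u ↔ (r : ℕ) < m := by
    by_cases hall : ∀ r : Fin k, (ν r + J r : ℤ) ≤ u
    · exact ⟨k, le_rfl, fun r => ⟨fun _ => r.is_lt, fun _ => hall r⟩⟩
    · push Not at hall
      obtain ⟨r₀, hr₀, hmin⟩ := WellFounded.has_min (wellFounded_lt (α := Fin k))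
        {r | u < (ν r + J r : ℤ)} hall
      refine ⟨r₀, r₀.is_lt.le, fun r => ⟨fun h => ?_, fun h => ?_⟩⟩
      · by_contra! hr
        simp only [Set.mem_ofPred_eq] at hr₀
        rcases hr.eq_or_lt with e | e
        · have : r₀ = r := Fin.ext e
          subst this
          omega
        · have := hJ.jump_lt_jump (r := r₀) (r' := r) e
          omega
      · by_contra! hr
        exact hmin r hr h
  obtain ⟨m, hm, h⟩ := key
  rw [markIndex_eq_of_iff hm h]
  exact h r

theorem markIndex_eq_of_before (hJ : JumpsInterlace ν J) (q : Fin k) {u : ℤ} (h1 : (ν q : ℤ) ≤ u)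
    (h2 : u < ν q + J q) : markIndex ν J u = q := by
  refine hJ.markIndex_eq q.is_lt.le (fun r hr => ?_) (fun r hr => ?_)
  · have := (hJ r).2
    rw [hr] at this
    omega
  · have : r = q := Fin.ext hr
    rwa [this]

theorem markIndex_eq_of_after (hJ : JumpsInterlace ν J) (q : Fin k) {u : ℤ}
    (h1 : (ν q + J q : ℤ) ≤ u) (h2 : u ≤ ν (q + 1)) : markIndex ν J u = q + 1 := by
  refine hJ.markIndex_eq q.is_lt (fun r hr => ?_) (fun r hr => ?_)
  · have : r = q := Fin.ext (by omega)
    rwa [this]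
  · have := (hJ r).1
    rw [← hr] at h2
    omega

theorem markIndex_eq_last (hJ : JumpsInterlace ν J) {u : ℤ} (h : (ν k : ℤ) ≤ u) :
    markIndex ν J u = k := by
  refine hJ.markIndex_eq le_rfl (fun r hr => ?_) (fun r hr => ?_)
  · have := (hJ r).2
    rw [hr] at this
    omega
  · exact absurd r.is_lt (by omega)

theorem markIndex_eq_zero (hJ : JumpsInterlace ν J) (h0 : ν 0 = 0) {u : ℤ} (h : u ≤ 0) :
    markIndex ν J u = 0 := by
  refine hJ.markIndex_eq (Nat.zero_le _) (fun r hr => by omega) (fun r hr => ?_)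
  have := (hJ r).1
  rw [hr, h0]
  push_cast
  omega

/-- The four kinds of times: in the backward tail, before or after a jump between two marks, or in
the forward tail. -/
theorem time_cases (hJ : JumpsInterlace ν J) (h0 : ν 0 = 0) (u : ℤ) :
    (∃ r : ℕ, 1 ≤ r ∧ u = -r) ∨ (∃ r : ℕ, 1 ≤ r ∧ u = ν k + r) ∨
    (0 ≤ u ∧ u ≤ ν k ∧ ∃ (q : Fin k) (i : ℕ), i < J q ∧ u = ν q + i) ∨
    (0 ≤ u ∧ u ≤ ν k ∧ (k = 0 ∨
      ∃ (q : Fin k) (i : ℕ), ν q + J q + i ≤ ν (q + 1) ∧ u = ν q + J q + i)) := by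
  rcases lt_or_ge u 0 with hu | hu
  · exact Or.inl ⟨(-u).toNat, by omega, by omega⟩
  rcases lt_or_ge (ν k : ℤ) u with hu' | hu'
  · exact Or.inr (Or.inl ⟨(u - ν k).toNat, by omega, by omega⟩)
  rcases Nat.eq_zero_or_pos k with rfl | hk
  · exact Or.inr (Or.inr (Or.inr ⟨hu, hu', Or.inl rfl⟩))
  set m := markIndex ν J u with hm
  have hmk : m ≤ k := markIndex_le ν J u
  by_cases hcase : (ν m : ℤ) ≤ u ∧ m < k
  · refine Or.inr (Or.inr (Or.inl ⟨hu, hu', ⟨m, hcase.2⟩, (u - ν m).toNat, ?_, ?_⟩))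
    · have := (hJ.jump_le_iff u ⟨m, hcase.2⟩).not.2 (by simp [← hm])
      simp only at this
      omega
    · simp only
      omega
  · refine Or.inr (Or.inr (Or.inr ⟨hu, hu', Or.inr ?_⟩))
    have hm0 : m ≠ 0 := by
      rintro h
      rw [h, h0] at hcase
      simp at hcase
      omega
    obtain ⟨q, hq⟩ : ∃ q, m = q + 1 := ⟨m - 1, by omega⟩
    have hqk : q < k := by omega
    have h1 := (hJ.jump_le_iff u ⟨q, hqk⟩).2 (by rw [← hm, hq]; exact Nat.lt_succ_self q)
    simp only at h1
    refine ⟨⟨q, hqk⟩, (u - ν q - J ⟨q, hqk⟩).toNat, ?_, ?_⟩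
    · simp only
      rcases hmk.eq_or_lt with e | e
      · rw [← hq, e]
        omega
      · rw [← hq]
        have : u < ν m := by
          by_contra! h
          exact hcase ⟨h, e⟩
        omega
    · simp only
      omega

theorem anchorIndex_before (hJ : JumpsInterlace ν J) (s : BinWord k) (q : Fin k) {i : ℕ}
    (hi : i < J q) : anchorIndex ν J s ((ν q : ℤ) + i) = ((s q.castSucc : ℕ) : ℤ) + i := by
  unfold anchorIndex
  rw [hJ.markIndex_eq_of_before q (by omega) (by omega), ← s.letter_val q.castSucc]
  simp
  ring

theorem anchorIndex_after (hJ : JumpsInterlace ν J) (s : BinWord k) (q : Fin k) {i : ℕ}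
    (hi : ν q + J q + i ≤ ν (q + 1)) : anchorIndex ν J s ((ν q : ℤ) + J q + i) =
      -((ν (q + 1) : ℤ) - ν q - J q - ((s q.succ : ℕ) : ℤ)) + i := by
  unfold anchorIndex
  rw [hJ.markIndex_eq_of_after q (by omega) (by omega),
    ← s.letter_val q.succ]
  simp
  ring

theorem anchorIndex_forward (hJ : JumpsInterlace ν J) (s : BinWord k) (r : ℕ) :
    anchorIndex ν J s ((ν k : ℤ) + r) = ((s (Fin.last k) : ℕ) : ℤ) + r := by
  unfold anchorIndex
  rw [hJ.markIndex_eq_last (by omega), ← s.letter_val (Fin.last k)]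
  simp
  ring

theorem anchorIndex_backward (hJ : JumpsInterlace ν J) (h0 : ν 0 = 0) (s : BinWord k) (r : ℕ) :
    anchorIndex ν J s (-(r : ℤ)) = ((s 0 : ℕ) : ℤ) - r := by
  unfold anchorIndex
  rw [hJ.markIndex_eq_zero h0 (by omega), ← s.letter_val 0, h0]
  simp
  ring

/-- Away from the jumps the anchor moves on by one. -/
theorem anchorIndex_succ (hJ : JumpsInterlace ν J) (s : BinWord k) (u : ℤ) :
    anchorIndex ν J s (u + 1) = anchorIndex ν J s u + 1 ∨
      ∃ q : Fin k, u + 1 = ν q + J q ∧ anchorIndex ν J s u = s.letter q + (J q - 1) ∧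
        anchorIndex ν J s (u + 1) = s.letter (q + 1) - (ν (q + 1) - ν q - J q) := by
  by_cases h : ∃ q : Fin k, u + 1 = ν q + J q
  · obtain ⟨q, hq⟩ := h
    refine Or.inr ⟨q, hq, ?_, ?_⟩
    · have := (hJ q).1
      unfold anchorIndex
      rw [hJ.markIndex_eq_of_before q (by omega) (by omega)]
      omega
    · have := (hJ q).2
      unfold anchorIndex
      rw [hJ.markIndex_eq_of_after q (by omega) (by omega)]
      omega
  · left
    push Not at h
    have : markIndex ν J (u + 1) = markIndex ν J u := by
      unfold markIndex
      congr 1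
      ext r
      have := h r
      simp only [Finset.mem_filter, Finset.mem_univ, true_and]
      omega
    unfold anchorIndex
    rw [this]
    ring

end JumpsInterlace

namespace TanYeZhangChoice

variable (D : TanYeZhangChoice)

/-! ### The growth of the marks -/

theorem mark_step {k : ℕ} (hk : 1 ≤ k) {q : ℕ} (hq : q < k) :
    100 * D.n k q ≤ D.n k (q + 1) := by
  rcases Nat.eq_zero_or_pos q with rfl | h
  · simp [D.n_zero k hk]
  · exact (D.n_step k hk q h hq).le

theorem first_mark_le {k : ℕ} (hk : 1 ≤ k) {q : ℕ} (hq : 1 ≤ q) (hqk : q ≤ k) :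
    D.n k 1 ≤ D.n k q := by
  induction q, hq using Nat.le_induction with
  | base => exact le_rfl
  | succ q hq ih =>
    have := ih (by omega)
    have := D.n_step k hk q hq (by omega)
    omega

theorem nine_mul_le_first_mark {k : ℕ} (hk : 1 ≤ k) : 9 * k ≤ D.n k 1 := by
  induction k, hk using Nat.le_induction with
  | base => simp [D.n_one_one]
  | succ k hk ih =>
    have := D.n_next k hk
    have := D.first_mark_le hk hk le_rfl
    omega

theorem nine_mul_le_mark {k : ℕ} (hk : 1 ≤ k) {q : ℕ} (hq : 1 ≤ q) (hqk : q ≤ k) :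
    9 * k ≤ D.n k q :=
  (D.nine_mul_le_first_mark hk).trans (D.first_mark_le hk hq hqk)

theorem mark_lt_mark {k : ℕ} (hk : 1 ≤ k) {q q' : ℕ} (hq : q < q') (hqk : q' ≤ k) :
    100 * D.n k q ≤ D.n k q' ∧ 0 < D.n k q' := by
  have hpos := D.nine_mul_le_mark hk (q := q') (by omega) hqk
  refine ⟨?_, by omega⟩
  induction q', hq using Nat.le_induction with
  | base => exact D.mark_step hk hqk
  | succ q' hq' ih =>
    have h1 := ih (by omega) (D.nine_mul_le_mark hk (by omega) (by omega))
    have := D.mark_step hk (q := q') (by omega)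
    omega

theorem mark_lt_first_mark {k k' : ℕ} (hk : 1 ≤ k) (hkk : k < k') :
    100 * D.n k k < D.n k' 1 := by
  induction k', hkk using Nat.le_induction with
  | base => exact D.n_next k hk
  | succ k' hk' ih =>
    have := D.n_next k' (by omega)
    have := D.first_mark_le (k := k') (by omega) (q := k') (by omega) le_rfl
    omega

/-- The positive marks of all levels form one lacunary set: of two different ones, the larger is at
least `100` times the smaller. -/
theorem mark_lacunary {k k' q q' : ℕ} (hq : 1 ≤ q) (hqk : q ≤ k) (hq' : 1 ≤ q') (hqk' : q' ≤ k')
    (hne : (k, q) ≠ (k', q')) :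
    100 * D.n k q ≤ D.n k' q' ∨ 100 * D.n k' q' ≤ D.n k q := by
  have key : ∀ {k k' q q' : ℕ}, 1 ≤ q → q ≤ k → 1 ≤ q' → q' ≤ k' → k < k' →
      100 * D.n k q ≤ D.n k' q' := by
    intro k k' q q' hq hqk hq' hqk' hkk
    have h1 := D.mark_lt_first_mark (k := k) (by omega) hkk
    have h2 := D.first_mark_le (k := k') (by omega) hq' hqk'
    have h3 : D.n k q ≤ D.n k k := by
      rcases hqk.eq_or_lt with rfl | h
      · exact le_rfl
      · have := (D.mark_lt_mark (k := k) (by omega) h le_rfl).1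
        omega
    omega
  rcases lt_trichotomy k k' with h | rfl | h
  · exact Or.inl (key hq hqk hq' hqk' h)
  · rcases lt_trichotomy q q' with h | rfl | h
    · exact Or.inl (D.mark_lt_mark (by omega) h hqk').1
    · exact absurd rfl hne
    · exact Or.inr (D.mark_lt_mark (by omega) h hqk).1
  · exact Or.inr (key hq' hqk' hq hqk h)

/-- The jump towards a mark takes place half-way, up to `k / 2`. -/
theorem jump_bounds {k : ℕ} (hk : 1 ≤ k) (s : BinWord k) (q : Fin k) :
    D.n k (q + 1) ≤ D.n k q + 2 * D.jump k s q + k ∧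
      D.n k q + 2 * D.jump k s q ≤ D.n k (q + 1) + k := by
  have h := abs_le.1 (D.jump_near k hk s q)
  constructor
  · have : (D.n k (q + 1) : ℝ) ≤ D.n k q + 2 * D.jump k s q + k := by linarith
    exact_mod_cast this
  · have : (D.n k q : ℝ) + 2 * D.jump k s q ≤ D.n k (q + 1) + k := by linarith
    exact_mod_cast this

theorem jumpsInterlace {k : ℕ} (hk : 1 ≤ k) (s : BinWord k) :
    JumpsInterlace (D.n k) (D.jump k s) := by
  intro r
  have h1 := D.jump_bounds hk s r
  have h2 := D.mark_step hk r.is_lt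
  have h3 := D.nine_mul_le_mark hk (q := r + 1) (by omega) r.is_lt
  constructor <;> omega

/-! ### The points follow their anchors -/

/-- The words of all the levels `k ≥ 1`: a word of level `k + 1` is recorded with the index `k`. -/
abbrev Word : Type := Σ k : ℕ, BinWord (k + 1)

/-- The level of a word. -/
abbrev Word.level (w : Word) : ℕ := w.1 + 1

/-- The points of the system: the points of `A` and the pairs of a word and a time. -/
abbrev Pt : Type := OnePoint ℤ ⊕ Word × ℤ

/-- The position of a point in the plane. -/
def pos : Pt → Plane := Sum.elim D.a fun p => D.x p.1.level p.1.2 p.2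

/-- The index of the anchor of `x_{s,i}`. -/
def anchor (p : Word × ℤ) : ℤ := anchorIndex (D.n p.1.level) (D.jump p.1.level p.1.2) p.1.2 p.2

/-- The level of the neighbourhood of its anchor which contains `x_{s,i}`. -/
def nearness (p : Word × ℤ) : ℕ := anchorLevel p.1.level (D.n p.1.level) p.2

theorem U_level_anti {k k' : ℕ} (hk : 1 ≤ k) (h : k ≤ k') (z : OnePoint ℤ) :
    D.U k' z ⊆ D.U k z := by
  induction k', h using Nat.le_induction with
  | base => exact subset_rfl
  | succ k' hk' ih => exact (D.U_anti k' (by omega) z).trans ih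

theorem x_mem_U {k : ℕ} (hk : 1 ≤ k) (s : BinWord k) (u : ℤ) :
    D.x k s u ∈
      D.U (anchorLevel k (D.n k) u) (anchorIndex (D.n k) (D.jump k s) s u : OnePoint ℤ) := by
  have hJ := D.jumpsInterlace hk s
  have h0 := D.n_zero k hk
  have hlev : 0 ≤ u → u ≤ D.n k k → anchorLevel k (D.n k) u = k := by
    intro h h'
    unfold anchorLevel
    omega
  rcases hJ.time_cases h0 u with ⟨r, hr, rfl⟩ | ⟨r, hr, rfl⟩ | ⟨hu, hu', q, i, hi, rfl⟩ |
    ⟨hu, hu', h | ⟨q, i, hi, rfl⟩⟩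
  · rw [hJ.anchorIndex_backward h0]
    have : anchorLevel k (D.n k) (-(r : ℤ)) = k + r := by
      unfold anchorLevel
      omega
    rw [this]
    exact D.x_backward k hk s r hr
  · rw [hJ.anchorIndex_forward]
    have : anchorLevel k (D.n k) ((D.n k k : ℤ) + r) = k + r := by
      unfold anchorLevel
      omega
    rw [this]
    exact D.x_forward k hk s r hr
  · rw [hJ.anchorIndex_before s q hi, hlev hu hu']
    exact D.x_before k hk s q i hi
  · omega
  · rw [hJ.anchorIndex_after s q hi, hlev hu hu']
    exact D.x_after k hk s q i hi

theorem pos_mem_U (p : Word × ℤ) :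
    D.pos (Sum.inr p) ∈ D.U (D.nearness p) (D.anchor p : OnePoint ℤ) :=
  D.x_mem_U (by simp) _ _

theorem level_le_nearness (p : Word × ℤ) : p.1.level ≤ D.nearness p := by
  unfold nearness anchorLevel
  omega

theorem dist_anchor_le (p : Word × ℤ) :
    dist (D.pos (Sum.inr p)) (D.a (D.anchor p : OnePoint ℤ)) ≤ 1 / (D.nearness p : ℝ) := by
  have h : 1 ≤ D.nearness p := le_trans (by simp) (D.level_le_nearness p)
  exact D.U_diam _ h _ _ (D.pos_mem_U p) _ (mem_of_mem_nhds (D.U_nhds _ h _))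

/-- Only finitely many points have a bounded level and a bounded time. -/
theorem finite_level_time (K : ℕ) (M : ℤ) :
    {p : Word × ℤ | p.1.level ≤ K ∧ |p.2| ≤ M}.Finite := by
  have hw : {w : Word | w.level ≤ K}.Finite := by
    have : {w : Word | w.level ≤ K} ⊆ ⋃ k ∈ Set.Iio K, Set.range (Sigma.mk (β := fun k : ℕ =>
        BinWord (k + 1)) k) := by
      rintro ⟨k, s⟩ h
      exact Set.mem_iUnion₂.2 ⟨k, h, s, rfl⟩
    exact ((Set.finite_Iio K).biUnion fun k _ => Set.finite_range _).subset this
  refine (hw.prod (Set.finite_Icc (-M) M)).subset ?_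
  rintro ⟨w, u⟩ ⟨h1, h2⟩
  exact ⟨h1, abs_le.1 h2⟩

theorem exists_last_mark_le (K : ℕ) : ∃ M : ℤ, ∀ k ≤ K, (D.n k k : ℤ) ≤ M := by
  refine ⟨∑ j ∈ Finset.range (K + 1), (D.n j j : ℤ), fun k hk => ?_⟩
  exact Finset.single_le_sum (f := fun j => (D.n j j : ℤ)) (fun _ _ => by positivity)
    (Finset.mem_range.2 (by omega))

theorem finite_nearness_le (R : ℕ) : {p : Word × ℤ | D.nearness p ≤ R}.Finite := by
  obtain ⟨M, hM⟩ := D.exists_last_mark_le R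
  refine (finite_level_time R (M + R)).subset ?_
  rintro ⟨w, u⟩ h
  have h' : anchorLevel w.level (D.n w.level) u ≤ R := h
  unfold anchorLevel at h'
  have hl : w.level ≤ R := by omega
  refine ⟨hl, ?_⟩
  have := hM _ hl
  have : 0 ≤ (D.n w.level w.level : ℤ) := by positivity
  show |u| ≤ _
  rw [abs_le]
  omega

/-- At a given level the anchors stay near the times, so that they leave every bounded set. -/
theorem abs_time_le (p : Word × ℤ) :
    |p.2| ≤ |D.anchor p| + D.n p.1.level p.1.level + 1 := by
  obtain ⟨w, u⟩ := p
  have h1 := markIndex_le (D.n w.level) (D.jump w.level w.2) u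
  have h2 := (D.jumpsInterlace (k := w.level) (by simp) w.2).mono h1 le_rfl
  have h3 := w.2.letter_le_one (markIndex (D.n w.level) (D.jump w.level w.2) u)
  have h4 : D.anchor (w, u) = anchorIndex (D.n w.level) (D.jump w.level w.2) w.2 u := rfl
  unfold anchorIndex at h4
  simp only
  rw [h4]
  rw [abs_le]
  set m := markIndex (D.n w.level) (D.jump w.level w.2) u
  have h5 := le_abs_self (u - D.n w.level m + w.2.letter m)
  have h6 := neg_abs_le (u - D.n w.level m + w.2.letter m)
  constructor <;> omega

theorem tendsto_nearness : Tendsto D.nearness cofinite atTop := by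
  rw [tendsto_atTop]
  intro b
  rw [eventually_cofinite]
  refine (D.finite_nearness_le b).subset fun p hp => ?_
  simp only [Set.mem_ofPred_eq] at hp ⊢
  omega

theorem tendsto_dist_anchor : Tendsto
    (fun p => dist (D.pos (Sum.inr p)) (D.a (D.anchor p : OnePoint ℤ))) cofinite (𝓝 0) :=
  squeeze_zero (fun _ => dist_nonneg) D.dist_anchor_le
    (tendsto_one_div_atTop_nhds_zero_nat.comp D.tendsto_nearness)

/-! ### The shift on the points -/

/-- The translation by `t` of the times and of the indices. -/
def shift (t : ℤ) : Pt → Pt := Sum.map (OnePoint.map (· + t)) fun p => (p.1, p.2 + t)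

end TanYeZhangChoice

/-! ### The space and its homeomorphism -/

theorem OnePoint.tendsto_coe_int_infty {ι : Type*} {l : Filter ι} {f : ι → ℤ} :
    Tendsto (fun p => (f p : OnePoint ℤ)) l (𝓝 OnePoint.infty) ↔ Tendsto f l cofinite := by
  have h := OnePoint.comap_coe_nhds_infty (X := ℤ)
  rw [coclosedCompact_eq_cocompact, cocompact_eq_cofinite] at h
  rw [← h, tendsto_comap_iff]
  rfl

theorem OnePoint.continuous_map_add_right (t : ℤ) :
    Continuous (OnePoint.map (· + t) : OnePoint ℤ → OnePoint ℤ) := by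
  refine OnePoint.continuous_map (continuous_of_discreteTopology) ?_
  rw [coclosedCompact_eq_cocompact, cocompact_eq_cofinite]
  exact (add_left_injective t).tendsto_cofinite

theorem tendsto_cofinite_of_finite_abs_le {ι : Type*} {l : Filter ι} {f : ι → ℤ}
    (h : ∀ L : ℤ, ∀ᶠ p in l, L < |f p|) : Tendsto f l cofinite := by
  intro S hS
  rw [mem_cofinite] at hS
  obtain ⟨M, hM⟩ := (hS.image abs).bddAbove
  rw [mem_map]
  filter_upwards [h M] with p hp
  by_contra hpS
  have := hM ⟨f p, hpS, rfl⟩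
  omega

theorem tendsto_of_comap_inl_inr {α β γ : Type*} {f : α ⊕ β → γ} {l : Filter (α ⊕ β)}
    {m : Filter γ} (h1 : Tendsto (f ∘ Sum.inl) (comap Sum.inl l) m)
    (h2 : Tendsto (f ∘ Sum.inr) (comap Sum.inr l) m) : Tendsto f l m := by
  intro S hS
  obtain ⟨t1, ht1, hs1⟩ := h1 hS
  obtain ⟨t2, ht2, hs2⟩ := h2 hS
  rw [mem_map]
  filter_upwards [ht1, ht2] with q hq1 hq2
  rcases q with q | q
  · exact hs1 hq1
  · exact hs2 hq2

namespace TanYeZhangChoice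

variable (D : TanYeZhangChoice)

theorem pos_injective : Function.Injective D.pos := by
  rintro (z | ⟨⟨k, s⟩, i⟩) (z' | ⟨⟨k', s'⟩, i'⟩) h
  · exact congrArg Sum.inl (D.a_embedding.injective h)
  · exact absurd ⟨z, h⟩ (D.x_not_mem (k' + 1) (by simp) s' i')
  · exact absurd ⟨z', h.symm⟩ (D.x_not_mem (k + 1) (by simp) s i)
  · by_cases hw : (⟨k + 1, s⟩ : Σ k : ℕ, BinWord k) = ⟨k' + 1, s'⟩
    · have e1 : k + 1 = k' + 1 := congrArg Sigma.fst hw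
      obtain rfl : k = k' := by omega
      obtain rfl : s = s' := by simpa using hw
      obtain rfl : i = i' := D.x_injective (k + 1) (by simp) s h
      rfl
    · exact absurd h ((D.x_disjoint _ _ (by simp) (by simp) hw).ne_of_mem ⟨i, rfl⟩ ⟨i', rfl⟩)

theorem isClosed_range_a : IsClosed (Set.range D.a) :=
  (isCompact_range D.a_embedding.continuous).isClosed

/-- The points can accumulate at points of `A` only. -/
theorem exists_nhds_finite_pos {y : Plane} (hy : y ∉ Set.range D.a) :
    ∃ N ∈ 𝓝 y, {q : Pt | D.pos q ∈ N}.Finite := by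
  obtain ⟨ε, hε, hball⟩ := Metric.isOpen_iff.1 D.isClosed_range_a.isOpen_compl y hy
  refine ⟨Metric.ball y (ε / 2), Metric.ball_mem_nhds y (by positivity), ?_⟩
  have hfin := eventually_cofinite.1
    (D.tendsto_dist_anchor.eventually (gt_mem_nhds (show (0 : ℝ) < ε / 2 by positivity)))
  refine (hfin.image Sum.inr).subset ?_
  rintro (z | p) hq
  · exact absurd ⟨z, rfl⟩ (hball (Metric.ball_subset_ball (by linarith) hq))
  · refine ⟨p, fun hp => ?_, rfl⟩
    have h1 : dist (D.pos (Sum.inr p)) y < ε / 2 := hq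
    refine hball (?_ : D.a (D.anchor p : OnePoint ℤ) ∈ _) ⟨_, rfl⟩
    rw [Metric.mem_ball]
    calc dist (D.a (D.anchor p : OnePoint ℤ)) y
        ≤ dist (D.a (D.anchor p : OnePoint ℤ)) (D.pos (Sum.inr p))
          + dist (D.pos (Sum.inr p)) y := dist_triangle _ _ _
      _ < ε / 2 + ε / 2 := by rw [dist_comm]; exact add_lt_add hp h1
      _ = ε := by ring

theorem isClosed_range_pos : IsClosed (Set.range D.pos) := by
  rw [← isOpen_compl_iff, isOpen_iff_mem_nhds]
  intro y hy
  have hyA : y ∉ Set.range D.a := fun ⟨z, hz⟩ => hy ⟨Sum.inl z, hz⟩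
  obtain ⟨N, hN, hfin⟩ := D.exists_nhds_finite_pos hyA
  have hc : IsClosed (D.pos '' {q : Pt | D.pos q ∈ N}) := (hfin.image _).isClosed
  have : (D.pos '' {q : Pt | D.pos q ∈ N})ᶜ ∈ 𝓝 y :=
    hc.isOpen_compl.mem_nhds fun ⟨q, _, hq⟩ => hy ⟨q, hq⟩
  filter_upwards [hN, this] with y' h1 h2
  rintro ⟨q, rfl⟩
  exact h2 ⟨q, h1, rfl⟩

theorem x_mem_X₁ (p : Word × ℤ) : D.pos (Sum.inr p) ∈ D.X₁ := by
  refine subset_closure ?_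
  simp only [Set.mem_iUnion]
  exact ⟨p.1.level, by simp, p.1.2, Or.inl ⟨p.2, rfl⟩⟩

/-- The orbit of the zero word of level `k` follows `a_i` at time `i`, for all small times. -/
theorem anchor_zero (k : ℕ) (i : ℤ) (hi : i ≤ k) : D.anchor (⟨k, fun _ => 0⟩, i) = i := by
  have hJ := D.jumpsInterlace (k := k + 1) (by simp) fun _ => 0
  have h0 := D.n_zero (k + 1) (by simp)
  have h1 : markIndex (D.n (k + 1)) (D.jump (k + 1) fun _ => 0) i = 0 := by
    refine hJ.markIndex_eq (Nat.zero_le _) (fun r hr => by omega) (fun r hr => ?_)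
    have h2 := D.jump_bounds (k := k + 1) (by simp) (fun _ => 0) r
    have h3 := D.mark_step (k := k + 1) (by simp) r.is_lt
    have h4 := D.nine_mul_le_mark (k := k + 1) (by simp) (q := r + 1) (by omega) r.is_lt
    omega
  change anchorIndex _ _ _ _ = _
  unfold anchorIndex
  rw [h1, h0]
  simp [BinWord.letter]

theorem range_a_subset : Set.range D.a ⊆ D.X₁ := by
  rintro _ ⟨z, rfl⟩
  induction z using OnePoint.rec with
  | infty =>
    refine subset_closure ?_
    simp only [Set.mem_iUnion]
    exact ⟨1, le_rfl, fun _ => 0, Or.inr rfl⟩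
  | coe i =>
    have hinj : Function.Injective fun k : ℕ => ((⟨k, fun _ => 0⟩, i) : Word × ℤ) := by
      intro k k' h
      exact congrArg (fun p : Word × ℤ => p.1.1) h
    have h := D.tendsto_dist_anchor.comp hinj.tendsto_cofinite
    rw [Nat.cofinite_eq_atTop] at h
    have h' : Tendsto (fun k : ℕ => D.pos (Sum.inr (⟨k, fun _ => 0⟩, i))) atTop
        (𝓝 (D.a (i : OnePoint ℤ))) := by
      rw [tendsto_iff_dist_tendsto_zero]
      refine h.congr' ?_
      filter_upwards [eventually_ge_atTop i.toNat] with k hk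
      simp only [Function.comp]
      rw [D.anchor_zero k i (by omega)]
    exact isClosed_closure.mem_of_tendsto h' (Eventually.of_forall fun k => D.x_mem_X₁ _)

theorem range_pos : Set.range D.pos = D.X₁ := by
  apply Set.Subset.antisymm
  · rintro _ ⟨z | p, rfl⟩
    · exact D.range_a_subset ⟨z, rfl⟩
    · exact D.x_mem_X₁ p
  · refine closure_minimal ?_ D.isClosed_range_pos
    simp only [Set.iUnion_subset_iff]
    rintro k hk s _ (⟨i, rfl⟩ | h)
    · obtain ⟨k, rfl⟩ : ∃ k', k = k' + 1 := ⟨k - 1, by omega⟩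
      exact ⟨Sum.inr (⟨k, s⟩, i), rfl⟩
    · exact ⟨Sum.inl OnePoint.infty, h.symm⟩

theorem isCompact_X₁ : IsCompact D.X₁ := by
  refine Metric.isCompact_of_isClosed_isBounded isClosed_closure ?_
  refine Metric.isBounded_closedBall (x := (0 : Plane)) (r := 2) |>.subset ?_
  rw [← D.range_pos]
  have ha : ∀ z, dist (D.a z) 0 = 1 := D.a_circle
  rintro _ ⟨z | p, rfl⟩
  · rw [Metric.mem_closedBall]
    exact (ha z).le.trans one_le_two
  · rw [Metric.mem_closedBall]
    have h1 := D.dist_anchor_le p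
    have h2 : 1 / (D.nearness p : ℝ) ≤ 1 := by
      have h : 1 ≤ D.nearness p := le_trans (by simp) (D.level_le_nearness p)
      rw [div_le_one (by exact_mod_cast h)]
      exact_mod_cast h
    have h3 := dist_triangle (D.pos (Sum.inr p)) (D.a (D.anchor p : OnePoint ℤ)) 0
    have h4 := ha (D.anchor p : OnePoint ℤ)
    linarith

instance compactSpace_X₁ : CompactSpace D.X₁ := isCompact_iff_compactSpace.1 D.isCompact_X₁

/-- The points of the system are the points of `X₁`. -/
def equivX₁ : Pt ≃ D.X₁ :=
  (Equiv.ofInjective D.pos D.pos_injective).trans (Equiv.setCongr D.range_pos)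

theorem coe_equivX₁ (q : Pt) : (D.equivX₁ q : Plane) = D.pos q := rfl

theorem pos_equivX₁_symm (y : D.X₁) : D.pos (D.equivX₁.symm y) = y := by
  rw [← coe_equivX₁, Equiv.apply_symm_apply]

theorem finite_level_anchor (K : ℕ) (L : ℤ) :
    {p : Word × ℤ | p.1.level ≤ K ∧ |D.anchor p| ≤ L}.Finite := by
  obtain ⟨M, hM⟩ := D.exists_last_mark_le K
  refine (finite_level_time K (L + M + 1)).subset ?_
  rintro p ⟨h1, h2⟩
  have := D.abs_time_le p
  have := hM _ h1
  exact ⟨h1, by omega⟩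

/-- The successor of a point `x_{s,i}` on its orbit. -/
def next (p : Word × ℤ) : Word × ℤ := (p.1, p.2 + 1)

theorem next_injective : Function.Injective next := by
  rintro ⟨w, i⟩ ⟨w', i'⟩ h
  simpa [next] using h

/-- The points from which the orbit jumps. -/
def jumpPoints : Set (Word × ℤ) := {p | D.anchor (next p) ≠ D.anchor p + 1}

theorem level_le_abs_anchor_of_mem_jumpPoints {p : Word × ℤ} (hp : p ∈ D.jumpPoints) :
    (p.1.level : ℤ) ≤ |D.anchor p| ∧ (p.1.level : ℤ) ≤ |D.anchor (next p)| := by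
  obtain ⟨w, u⟩ := p
  have hw : 1 ≤ w.level := by simp
  rcases (D.jumpsInterlace hw w.2).anchorIndex_succ w.2 u with h | ⟨q, hu, h1, h2⟩
  · exact absurd h hp
  · have e1 : D.anchor (w, u) = _ := h1
    have e2 : D.anchor (next (w, u)) = _ := h2
    have h2 := D.jump_bounds hw w.2 q
    have h3 := D.mark_step hw q.is_lt
    have h4 := D.nine_mul_le_mark hw (q := q + 1) (by omega) q.is_lt
    have h5 := w.2.letter_le_one (q + 1)
    rw [e1, e2]
    simp only
    constructor
    · rw [le_abs]
      left
      omega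
    · rw [le_abs]
      right
      omega

/-- The points from which the orbit jumps have anchors far out, before and after the jump. -/
theorem tendsto_anchor_jumpPoints :
    Tendsto D.anchor (cofinite ⊓ 𝓟 D.jumpPoints) cofinite ∧
      Tendsto (D.anchor ∘ next) (cofinite ⊓ 𝓟 D.jumpPoints) cofinite := by
  constructor
  · refine tendsto_cofinite_of_finite_abs_le fun L => ?_
    rw [eventually_inf_principal, eventually_cofinite]
    refine (D.finite_level_anchor L.toNat L).subset fun p hp => ?_
    simp only [Set.mem_ofPred_eq, Classical.not_imp, not_lt] at hp ⊢
    have := (D.level_le_abs_anchor_of_mem_jumpPoints hp.1).1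
    omega
  · refine tendsto_cofinite_of_finite_abs_le fun L => ?_
    rw [eventually_inf_principal, eventually_cofinite]
    refine ((D.finite_level_anchor L.toNat L).preimage next_injective.injOn).subset fun p hp => ?_
    simp only [Set.mem_ofPred_eq, Classical.not_imp, not_lt, Function.comp, Set.mem_preimage]
      at hp ⊢
    have := (D.level_le_abs_anchor_of_mem_jumpPoints hp.1).2
    have e : (next p).1 = p.1 := rfl
    rw [e]
    omega

/-- Continuity of the shift at the points of `A`. -/
theorem tendsto_pos_shift_one (z : OnePoint ℤ) :
    Tendsto (D.pos ∘ shift 1) (comap D.pos (𝓝 (D.a z))) (𝓝 (D.a (OnePoint.map (· + 1) z))) := by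
  refine tendsto_of_comap_inl_inr ?_ ?_
  · rw [comap_comap]
    have h1 : comap (D.pos ∘ Sum.inl) (𝓝 (D.a z)) = 𝓝 z := (D.a_embedding.nhds_eq_comap z).symm
    rw [h1]
    exact (D.a_embedding.continuous.comp (OnePoint.continuous_map_add_right 1)).continuousAt
  · rw [comap_comap]
    set F := comap (D.pos ∘ Sum.inr) (𝓝 (D.a z)) with hF
    have hcof : F ≤ cofinite := by
      rw [le_cofinite_iff_compl_singleton_mem]
      intro p
      refine ⟨{D.pos (Sum.inr p)}ᶜ, compl_singleton_mem_nhds ?_, ?_⟩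
      · exact fun h => D.x_not_mem _ (by simp) p.1.2 p.2 ⟨z, h⟩
      · rintro p' h rfl
        exact h rfl
    have hz : Tendsto (fun p => (D.anchor p : OnePoint ℤ)) F (𝓝 z) := by
      rw [D.a_embedding.tendsto_nhds_iff]
      exact tendsto_comap.congr_dist (D.tendsto_dist_anchor.mono_left hcof)
    have hz' : Tendsto (fun p => (D.anchor (next p) : OnePoint ℤ)) F
        (𝓝 (OnePoint.map (· + 1) z)) := by
      have hsplit : F = F ⊓ 𝓟 D.jumpPoints ⊔ F ⊓ 𝓟 D.jumpPointsᶜ := by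
        rw [← inf_sup_left, sup_principal, Set.union_compl_self, principal_univ, inf_top_eq]
      rw [hsplit, tendsto_sup]
      constructor
      · -- along jumps the anchors go to infinity, which forces `z = ∞`
        rcases eq_or_neBot (F ⊓ 𝓟 D.jumpPoints) with hbot | hne
        · rw [hbot]
          exact tendsto_bot
        · have hle : F ⊓ 𝓟 D.jumpPoints ≤ cofinite ⊓ 𝓟 D.jumpPoints := inf_le_inf_right _ hcof
          have h1 := OnePoint.tendsto_coe_int_infty.2 (D.tendsto_anchor_jumpPoints.1.mono_left hle)
          have h2 := OnePoint.tendsto_coe_int_infty.2 (D.tendsto_anchor_jumpPoints.2.mono_left hle)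
          rw [tendsto_nhds_unique (hz.mono_left inf_le_left) h1]
          exact h2
      · refine (((OnePoint.continuous_map_add_right 1).tendsto z).comp
          (hz.mono_left inf_le_left)).congr' ?_
        filter_upwards [mem_inf_of_right (mem_principal_self _)] with p hp
        have : D.anchor (next p) = D.anchor p + 1 := not_not.1 hp
        simp [this]
    have h3 : Tendsto (fun p => D.a (D.anchor (next p) : OnePoint ℤ)) F
        (𝓝 (D.a (OnePoint.map (· + 1) z))) := (D.a_embedding.continuous.tendsto _).comp hz'
    refine h3.congr_dist ?_
    refine ((D.tendsto_dist_anchor.comp next_injective.tendsto_cofinite).mono_left hcof).congr ?_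
    intro p
    exact dist_comm _ _

theorem shift_zero (q : Pt) : shift 0 q = q := by
  rcases q with z | p
  · induction z using OnePoint.rec <;> simp [shift]
  · simp [shift]

theorem shift_add (t t' : ℤ) (q : Pt) : shift (t + t') q = shift t (shift t' q) := by
  rcases q with z | p
  · induction z using OnePoint.rec <;> simp [shift]; ring_nf
  · simp [shift]
    ring

/-- The shift as a permutation of the points. -/
def shiftEquiv (t : ℤ) : Pt ≃ Pt where
  toFun := shift t
  invFun := shift (-t)
  left_inv q := by rw [← shift_add, neg_add_cancel, shift_zero]
  right_inv q := by rw [← shift_add, add_neg_cancel, shift_zero]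

theorem continuous_conj_shift :
    Continuous (D.equivX₁.symm.trans ((shiftEquiv 1).trans D.equivX₁)) := by
  rw [continuous_iff_continuousAt]
  intro y
  obtain ⟨q, rfl⟩ := D.equivX₁.surjective y
  rcases q with z | p
  · rw [ContinuousAt, Topology.IsEmbedding.subtypeVal.tendsto_nhds_iff]
    have e : D.equivX₁.symm.trans ((shiftEquiv 1).trans D.equivX₁) (D.equivX₁ (Sum.inl z)) =
        D.equivX₁ (Sum.inl (OnePoint.map (· + 1) z)) := by
      simp only [Equiv.trans_apply, Equiv.symm_apply_apply]
      rfl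
    rw [e]
    have h : Tendsto D.equivX₁.symm (𝓝 (D.equivX₁ (Sum.inl z))) (comap D.pos (𝓝 (D.a z))) := by
      rw [tendsto_comap_iff]
      have : D.pos ∘ D.equivX₁.symm = Subtype.val := funext D.pos_equivX₁_symm
      rw [this]
      exact continuous_subtype_val.tendsto _
    exact (D.tendsto_pos_shift_one z).comp h
  · -- the points `x_{s,i}` are isolated
    obtain ⟨N, hN, hfin⟩ := D.exists_nhds_finite_pos
      (D.x_not_mem p.1.level (by simp) p.1.2 p.2)
    have hiso : IsOpen ({D.equivX₁ (Sum.inr p)} : Set D.X₁) := by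
      have hN' : Subtype.val ⁻¹' N ∈ 𝓝 (D.equivX₁ (Sum.inr p)) :=
        continuous_subtype_val.continuousAt hN
      have hfin' : (Subtype.val ⁻¹' N : Set D.X₁).Finite := by
        refine (hfin.image D.equivX₁).subset fun y hy => ?_
        refine ⟨D.equivX₁.symm y, ?_, D.equivX₁.apply_symm_apply y⟩
        simp only [Set.mem_ofPred_eq]
        rw [D.pos_equivX₁_symm]
        exact hy
      exact isOpen_singleton_of_finite_mem_nhds _ hN' hfin'
    have := isOpen_singleton_iff_nhds_eq_pure _ |>.1 hiso
    rw [ContinuousAt, this]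
    exact tendsto_pure_left.2 fun s hs => mem_of_mem_nhds hs

/-- The homeomorphism of `X₁` induced by the shift. -/
def shiftHomeomorph : D.X₁ ≃ₜ D.X₁ := D.continuous_conj_shift.homeoOfEquivCompactToT2

theorem shiftHomeomorph_equivX₁ (q : Pt) :
    D.shiftHomeomorph (D.equivX₁ q) = D.equivX₁ (shift 1 q) := by
  change D.equivX₁ (shift 1 (D.equivX₁.symm (D.equivX₁ q))) = _
  rw [Equiv.symm_apply_apply]

theorem isShift_iff (T : D.X₁ ≃ₜ D.X₁) :
    D.IsShift T ↔ ∀ q, T (D.equivX₁ q) = D.equivX₁ (shift 1 q) := by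
  constructor
  · intro h q
    apply Subtype.ext
    obtain ⟨h1, h2, h3⟩ := h (D.equivX₁ q)
    rcases q with z | ⟨⟨k, s⟩, i⟩
    · induction z using OnePoint.rec with
      | infty => exact h2 rfl
      | coe i => exact h1 i rfl
    · exact h3 (k + 1) (by simp) s i rfl
  · intro h y
    refine ⟨fun i hi => ?_, fun hi => ?_, fun k hk s i hi => ?_⟩
    · obtain rfl : y = D.equivX₁ (Sum.inl (i : OnePoint ℤ)) := Subtype.ext hi
      rw [h]
      rfl
    · obtain rfl : y = D.equivX₁ (Sum.inl OnePoint.infty) := Subtype.ext hi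
      rw [h]
      rfl
    · obtain ⟨k, rfl⟩ : ∃ k', k = k' + 1 := ⟨k - 1, by omega⟩
      obtain rfl : y = D.equivX₁ (Sum.inr (⟨k, s⟩, i)) := Subtype.ext hi
      rw [h]
      rfl

theorem existsUnique_isShift : ∃! T : D.X₁ ≃ₜ D.X₁, D.IsShift T := by
  refine ⟨D.shiftHomeomorph, (D.isShift_iff _).2 D.shiftHomeomorph_equivX₁, fun T hT => ?_⟩
  ext1 y
  obtain ⟨q, rfl⟩ := D.equivX₁.surjective y
  rw [(D.isShift_iff T).1 hT, shiftHomeomorph_equivX₁]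

theorem zpow_equivX₁ {T : D.X₁ ≃ₜ D.X₁} (hT : D.IsShift T) (t : ℤ) (q : Pt) :
    (T ^ t) (D.equivX₁ q) = D.equivX₁ (shift t q) := by
  have h1 := (D.isShift_iff T).1 hT
  have h2 : ∀ q, T⁻¹ (D.equivX₁ q) = D.equivX₁ (shift (-1) q) := by
    intro q
    have : D.equivX₁ q = T (D.equivX₁ (shift (-1) q)) := by
      rw [h1, ← shift_add, add_neg_cancel, shift_zero]
    rw [this]
    exact T.symm_apply_apply _
  induction t generalizing q with
  | zero => rw [shift_zero]; rfl
  | succ t ih =>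
    rw [zpow_add_one, shift_add, ← ih, ← h1]
    rfl
  | pred t ih =>
    rw [zpow_sub_one, sub_eq_add_neg, shift_add, ← ih, ← h2]
    rfl

end TanYeZhangChoice

namespace TanYeZhangChoice

variable (D : TanYeZhangChoice)

/-! ### Coding the system -/

/-- The code of a point of `A`: its index if that is in the window `[-L, L]`, and nothing
otherwise. -/
def codeA (L : ℤ) (z : ℤ) : Option Pt :=
  if |z| ≤ L then some (Sum.inl (z : OnePoint ℤ)) else none

open Classical in
/-- The code of a point: the points of the finite set `P₀` are their own codes, the other points
have the code of their anchor. -/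
def code (L : ℤ) (P₀ : Finset (Word × ℤ)) : Pt → Option Pt
  | Sum.inl (some z) => codeA L z
  | Sum.inl none => none
  | Sum.inr p => if p ∈ P₀ then some (Sum.inr p) else codeA L (D.anchor p)

/-- The conditions on `L`, `K` and `P₀` under which the codes can be counted: the finite set `P₀`
accounts for the orbits of the levels up to `K`, and at the higher levels the marks are far apart
in comparison with the window. -/
structure IsCoding (L : ℤ) (K : ℕ) (P₀ : Finset (Word × ℤ)) : Prop where
  nonneg : 0 ≤ L
  level_le : ∀ p ∈ P₀, p.1.level ≤ K
  far : ∀ p : Word × ℤ, p.1.level ≤ K → p ∉ P₀ → L < |D.anchor p|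
  large : ∀ k, K < k → 100 * (L + 1) ≤ D.n k 1

/-- There are codes as fine as one likes. -/
theorem exists_isCoding {δ : ℝ} (hδ : 0 < δ) :
    ∃ L K P₀, D.IsCoding L K P₀ ∧
      ∀ q q', D.code L P₀ q = D.code L P₀ q' → dist (D.pos q) (D.pos q') < δ := by
  have hA : {z : ℤ | ¬ dist (D.a z) (D.a OnePoint.infty) < δ / 4}.Finite := by
    have h1 : Tendsto (fun z : ℤ => (z : OnePoint ℤ)) cofinite (𝓝 OnePoint.infty) :=
      OnePoint.tendsto_coe_int_infty.2 tendsto_id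
    have h2 := (D.a_embedding.continuous.tendsto _).comp h1
    exact eventually_cofinite.1 (Metric.tendsto_nhds.1 h2 (δ / 4) (by positivity))
  have hE : {p : Word × ℤ |
      ¬ dist (D.pos (Sum.inr p)) (D.a (D.anchor p : OnePoint ℤ)) < δ / 4}.Finite :=
    eventually_cofinite.1
      (D.tendsto_dist_anchor.eventually (gt_mem_nhds (show (0 : ℝ) < δ / 4 by positivity)))
  obtain ⟨L₀, hL₀⟩ := (hA.image abs).bddAbove
  obtain ⟨K₀, hK₀⟩ := (hE.image fun p => p.1.level).bddAbove
  set L := max L₀ 0 with hL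
  have hL0 : 0 ≤ L := le_max_right _ _
  set K := max K₀ (100 * (L + 1)).toNat with hK
  set P₀ : Finset (Word × ℤ) := ((D.finite_level_anchor K L).union hE).toFinset with hP
  have hmem : ∀ p, p ∈ P₀ ↔ (p.1.level ≤ K ∧ |D.anchor p| ≤ L) ∨
      ¬ dist (D.pos (Sum.inr p)) (D.a (D.anchor p : OnePoint ℤ)) < δ / 4 := by
    intro p
    rw [hP, Set.Finite.mem_toFinset]
    rfl
  refine ⟨L, K, P₀, ⟨hL0, fun p hp => ?_, fun p h1 h2 => ?_, fun k hk => ?_⟩, ?_⟩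
  · rcases (hmem p).1 hp with h | h
    · exact h.1
    · exact (hK₀ ⟨p, h, rfl⟩).trans (le_max_left _ _)
  · by_contra! h
    exact h2 ((hmem p).2 (Or.inl ⟨h1, h⟩))
  · have h1 := D.nine_mul_le_first_mark (k := k) (by omega)
    have h2 : (100 * (L + 1)).toNat ≤ K := le_max_right _ _
    omega
  · -- a code stands for a point, from which all the points with that code are close
    let target : Option Pt → Plane := fun o => o.elim (D.a OnePoint.infty) D.pos
    have hcodeA : ∀ z : ℤ, dist (D.a z) (target (codeA L z)) < δ / 4 := by
      intro z
      unfold codeA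
      split_ifs with h
      · change dist (D.a z) (D.a z) < _
        rw [dist_self]
        positivity
      · change dist (D.a z) (D.a OnePoint.infty) < _
        by_contra hz
        have : |z| ≤ L₀ := hL₀ ⟨z, hz, rfl⟩
        exact h (this.trans (le_max_left _ _))
    have hcode : ∀ q, dist (D.pos q) (target (D.code L P₀ q)) < δ / 2 := by
      rintro (z | p)
      · induction z using OnePoint.rec with
        | infty =>
          change dist (D.a OnePoint.infty) (D.a OnePoint.infty) < _
          rw [dist_self]
          positivity
        | coe z => exact (hcodeA z).trans (by linarith)
      · change dist _ (target (if p ∈ P₀ then some (Sum.inr p) else codeA L (D.anchor p))) < _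
        split_ifs with h
        · change dist (D.pos (Sum.inr p)) (D.pos (Sum.inr p)) < _
          rw [dist_self]
          positivity
        · have h1 : dist (D.pos (Sum.inr p)) (D.a (D.anchor p : OnePoint ℤ)) < δ / 4 := by
            by_contra h'
            exact h ((hmem p).2 (Or.inr h'))
          have h2 := hcodeA (D.anchor p)
          have h3 := dist_triangle (D.pos (Sum.inr p)) (D.a (D.anchor p : OnePoint ℤ))
            (target (codeA L (D.anchor p)))
          linarith
    intro q q' h
    have h1 := hcode q
    have h2 := hcode q'
    rw [← h, dist_comm] at h2
    have h3 := dist_triangle (D.pos q) (target (D.code L P₀ q)) (D.pos q')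
    linarith

/-! ### Counting the patterns of codes -/

/-- The codes of a point at the times `t 0, t 1, …`. -/
def pattern (L : ℤ) (P₀ : Finset (Word × ℤ)) {n : ℕ} (t : Fin n → ℤ) (q : Pt) :
    Fin n → Option Pt :=
  fun j => D.code L P₀ (shift (t j) q)

open Classical in
/-- The marks near which an orbit of level `k` is found at one of the times `i + t j`. -/
def visited (L : ℤ) (k : ℕ) (i : ℤ) {n : ℕ} (t : Fin n → ℤ) : Finset ℕ :=
  (Finset.range (k + 1)).filter fun q => ∃ j, |i + t j - D.n k q| ≤ L + 1

theorem mem_visited {L : ℤ} {k : ℕ} {i : ℤ} {n : ℕ} {t : Fin n → ℤ} {q : ℕ} :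
    q ∈ D.visited L k i t ↔ q ≤ k ∧ ∃ j, |i + t j - D.n k q| ≤ L + 1 := by
  simp [visited]

open Classical in
/-- The codes at the times `i + t j` on the orbit of level `k` whose word has the letter `1` exactly
at the marks in `B`. -/
def markPattern (L : ℤ) (k : ℕ) (i : ℤ) {n : ℕ} (t : Fin n → ℤ) (B : Finset ℕ) :
    Fin n → Option Pt :=
  fun j => if h : ∃ q ≤ k, |i + t j - D.n k q| ≤ L + 1 then
    codeA L (i + t j - D.n k h.choose + if h.choose ∈ B then 1 else 0) else none

namespace IsCoding

variable {D} {L : ℤ} {K : ℕ} {P₀ : Finset (Word × ℤ)}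

theorem large_mark (hc : D.IsCoding L K P₀) {k q : ℕ} (hk : K < k) (hq : 1 ≤ q) (hqk : q ≤ k) :
    100 * (L + 1) ≤ D.n k q := by
  have h1 := hc.large k hk
  have h2 := D.first_mark_le (by omega) hq hqk
  omega

theorem anchor_eq (hc : D.IsCoding L K P₀) {w : Word} (hw : K < w.level) {u : ℤ} {q : ℕ}
    (hq : q ≤ w.level) (hu : |u - D.n w.level q| ≤ L + 1) :
    D.anchor (w, u) = u - D.n w.level q + w.2.letter q := by
  have hw1 : 1 ≤ w.level := by simp
  have hu' := abs_le.1 hu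
  have hm : markIndex (D.n w.level) (D.jump w.level w.2) u = q := by
    refine (D.jumpsInterlace hw1 w.2).markIndex_eq hq (fun r hr => ?_) (fun r hr => ?_)
    · have h1 := D.jump_bounds hw1 w.2 r
      have h2 := D.mark_step hw1 r.is_lt
      have h3 := D.nine_mul_le_mark hw1 (q := r + 1) (by omega) r.is_lt
      have h4 := hc.large_mark hw (q := r + 1) (by omega) r.is_lt
      rw [hr] at h1 h2 h3 h4
      omega
    · have h1 := D.jump_bounds hw1 w.2 r
      have h2 := D.mark_step hw1 r.is_lt
      have h3 := D.nine_mul_le_mark hw1 (q := r + 1) (by omega) r.is_lt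
      have h4 := hc.large_mark hw (q := r + 1) (by omega) r.is_lt
      rw [← hr] at hu'
      omega
  change anchorIndex _ _ _ _ = _
  unfold anchorIndex
  rw [hm]

theorem exists_mark_of_abs_anchor_le {w : Word} {u : ℤ} (h : |D.anchor (w, u)| ≤ L) :
    ∃ q ≤ w.level, |u - D.n w.level q| ≤ L + 1 := by
  refine ⟨_, markIndex_le (D.n w.level) (D.jump w.level w.2) u, ?_⟩
  have h' : |anchorIndex (D.n w.level) (D.jump w.level w.2) w.2 u| ≤ L := h
  unfold anchorIndex at h'
  have := w.2.letter_le_one (markIndex (D.n w.level) (D.jump w.level w.2) u)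
  rw [abs_le] at h' ⊢
  omega

theorem code_inr (hc : D.IsCoding L K P₀) {w : Word} (hw : K < w.level) (u : ℤ) :
    D.code L P₀ (Sum.inr (w, u)) = codeA L (D.anchor (w, u)) := by
  refine if_neg fun h => ?_
  have := hc.level_le _ h
  simp only at this
  omega

open Classical in
theorem pattern_eq_markPattern (hc : D.IsCoding L K P₀) {w : Word} (hw : K < w.level) (i : ℤ)
    {n : ℕ} (t : Fin n → ℤ) :
    D.pattern L P₀ t (Sum.inr (w, i)) = D.markPattern L w.level i t
      ((D.visited L w.level i t).filter fun q => w.2.letter q = 1) := by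
  funext j
  change D.code L P₀ (Sum.inr (w, i + t j)) = _
  rw [hc.code_inr hw]
  unfold markPattern
  split_ifs with h h'
  · obtain ⟨h1, h2⟩ := h.choose_spec
    rw [hc.anchor_eq hw h1 h2, (Finset.mem_filter.1 h').2]
    rfl
  · obtain ⟨h1, h2⟩ := h.choose_spec
    rw [hc.anchor_eq hw h1 h2]
    have h3 := w.2.letter_le_one h.choose
    have h4 : w.2.letter h.choose ≠ 1 := fun e =>
      h' (Finset.mem_filter.2 ⟨D.mem_visited.2 ⟨h1, j, h2⟩, e⟩)
    have h5 : w.2.letter h.choose = 0 := by omega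
    rw [h5]
    rfl
  · exact if_neg fun h' => h (exists_mark_of_abs_anchor_le h')

/-- An orbit that is seen near at most one mark has the pattern of a point of `A`. -/
theorem exists_pattern_inl (hc : D.IsCoding L K P₀) {w : Word} (hw : K < w.level) (i : ℤ)
    {n : ℕ} (t : Fin n → ℤ) (hv : (D.visited L w.level i t).card ≤ 1) :
    ∃ z, D.pattern L P₀ t (Sum.inr (w, i)) = D.pattern L P₀ t (Sum.inl z) := by
  by_cases hex : ∃ q, q ∈ D.visited L w.level i t
  · obtain ⟨q, hq⟩ := hex
    refine ⟨((i - D.n w.level q + w.2.letter q : ℤ) : OnePoint ℤ), ?_⟩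
    funext j
    change D.code L P₀ (Sum.inr (w, i + t j)) = codeA L (i - D.n w.level q + w.2.letter q + t j)
    rw [hc.code_inr hw]
    by_cases hj : ∃ q' ≤ w.level, |i + t j - D.n w.level q'| ≤ L + 1
    · obtain ⟨q', h1, h2⟩ := hj
      obtain rfl : q = q' := Finset.card_le_one.1 hv q hq q' (D.mem_visited.2 ⟨h1, j, h2⟩)
      rw [hc.anchor_eq hw h1 h2]
      congr 1
      ring
    · have h1 : codeA L (D.anchor (w, i + t j)) = none :=
        if_neg fun h' => hj (exists_mark_of_abs_anchor_le h')
      have h2 : codeA L (i - D.n w.level q + w.2.letter q + t j) = none := by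
        refine if_neg fun h' => hj ⟨q, (D.mem_visited.1 hq).1, ?_⟩
        have := w.2.letter_le_one q
        rw [abs_le] at h' ⊢
        omega
      rw [h1, h2]
  · refine ⟨OnePoint.infty, ?_⟩
    funext j
    change D.code L P₀ (Sum.inr (w, i + t j)) = none
    rw [hc.code_inr hw]
    refine if_neg fun h' => hex ?_
    obtain ⟨q, h1, h2⟩ := exists_mark_of_abs_anchor_le h'
    exact ⟨q, D.mem_visited.2 ⟨h1, j, h2⟩⟩

/-- Two marks visited at known times determine the level and the position of the orbit, because the
difference of two marks determines the larger one. -/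
theorem level_time_unique {k k' q₁ q₂ q₁' q₂' : ℕ} {i i' d₁ d₂ t₁ t₂ : ℤ}
    (h12 : q₁ < q₂) (hk : q₂ ≤ k) (h12' : q₁' < q₂') (hk' : q₂' ≤ k')
    (e1 : i + t₁ - D.n k q₁ = d₁) (e2 : i + t₂ - D.n k q₂ = d₂)
    (e1' : i' + t₁ - D.n k' q₁' = d₁) (e2' : i' + t₂ - D.n k' q₂' = d₂) :
    (k, i) = (k', i') := by
  have h1 := D.mark_lt_mark (k := k) (by omega) h12 hk
  have h1' := D.mark_lt_mark (k := k') (by omega) h12' hk'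
  by_cases hne : (k, q₂) = (k', q₂')
  · obtain ⟨rfl, rfl⟩ := Prod.mk.inj hne
    have : i = i' := by omega
    rw [this]
  · have := D.mark_lacunary (k := k) (k' := k') (by omega) hk (by omega) hk' hne
    omega

/-- The larger of two marks with a known sum is determined. -/
theorem mark_unique_of_sum (hc : D.IsCoding L K P₀) {k q₁ q₂ m₁ m₂ : ℕ} {N : ℤ} (hk : K < k)
    (hq₁ : q₁ ≤ k) (hq₂ : q₂ ≤ k) (h1 : m₁ ≤ D.n k q₁) (h2 : m₂ ≤ D.n k q₂)
    (hN1 : |D.n k q₁ + m₁ - N| ≤ 2 * (L + 1)) (hN2 : |D.n k q₂ + m₂ - N| ≤ 2 * (L + 1)) :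
    q₁ = q₂ := by
  have hL := hc.nonneg
  rw [abs_le] at hN1 hN2
  rcases lt_trichotomy q₁ q₂ with h | h | h
  · have := D.mark_lt_mark (k := k) (by omega) h hq₂
    have := hc.large_mark hk (q := q₂) (by omega) hq₂
    omega
  · exact h
  · have := D.mark_lt_mark (k := k) (by omega) h hq₁
    have := hc.large_mark hk (q := q₁) (by omega) hq₁
    omega

theorem mark_unique (hc : D.IsCoding L K P₀) {k q₁ q₂ : ℕ} {N : ℤ} (hk : K < k)
    (hq₁ : q₁ ≤ k) (hq₂ : q₂ ≤ k) (hN1 : |N - D.n k q₁| ≤ L + 1) (hN2 : |N - D.n k q₂| ≤ L + 1) :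
    q₁ = q₂ := by
  have hL := hc.nonneg
  rw [abs_le] at hN1 hN2
  refine hc.mark_unique_of_sum (m₁ := 0) (m₂ := 0) (N := N) hk hq₁ hq₂ (Nat.zero_le _)
    (Nat.zero_le _) ?_ ?_ <;> rw [abs_le] <;> omega

theorem exists_representatives (hc : D.IsCoding L K P₀) {k : ℕ} (hk : K < k) (i : ℤ) {n : ℕ}
    (t : Fin n → ℤ) : ∃ A : Finset (Fin n), A.card = (D.visited L k i t).card ∧
      (∀ j ∈ A, ∃ q ≤ k, |i + t j - D.n k q| ≤ L + 1) ∧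
      ∀ j ∈ A, ∀ j' ∈ A, ∀ q ≤ k, |i + t j - D.n k q| ≤ L + 1 → |i + t j' - D.n k q| ≤ L + 1 →
        j = j' := by
  classical
  have h : ∀ q : D.visited L k i t, ∃ j, |i + t j - D.n k q| ≤ L + 1 :=
    fun q => (D.mem_visited.1 q.2).2
  choose f hf using h
  have hle : ∀ q : D.visited L k i t, (q : ℕ) ≤ k := fun q => (D.mem_visited.1 q.2).1
  have key : ∀ (q : D.visited L k i t) (q' : ℕ), q' ≤ k → |i + t (f q) - D.n k q'| ≤ L + 1 →
      (q : ℕ) = q' := fun q q' hq' h' => hc.mark_unique hk (hle q) hq' (hf q) h'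
  have hinj : Function.Injective f := by
    intro q q' hqq
    exact Subtype.ext (key q q' (hle q') (hqq ▸ hf q'))
  refine ⟨Finset.univ.image f, ?_, ?_, ?_⟩
  · rw [Finset.card_image_of_injective _ hinj]
    simp
  · intro j hj
    obtain ⟨q, -, rfl⟩ := Finset.mem_image.1 hj
    exact ⟨q, hle q, hf q⟩
  · intro j hj j' hj' q hq h1 h2
    obtain ⟨r, -, rfl⟩ := Finset.mem_image.1 hj
    obtain ⟨r', -, rfl⟩ := Finset.mem_image.1 hj'
    have e1 := key r q hq h1
    have e2 := key r' q hq h2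
    rw [Subtype.ext (e1.trans e2.symm)]

theorem card_visited_le (hc : D.IsCoding L K P₀) {k : ℕ} (hk : K < k) (i : ℤ) {n : ℕ}
    (t : Fin n → ℤ) : (D.visited L k i t).card ≤ n := by
  obtain ⟨A, hA, -⟩ := hc.exists_representatives hk i t
  rw [← hA]
  exact (Finset.card_le_univ A).trans (by simp)

/-- An orbit followed forwards and an orbit followed backwards are hardly ever near marks at the
same time: at such a time the sum of the two marks is known up to a bounded error, which determines
the larger of them. So together the two orbits visit at most `n + 2` marks at `n` times. -/
theorem card_visited_add_card_visited_neg_le (hc : D.IsCoding L K P₀) {k k' : ℕ} (hk : K < k)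
    (hk' : K < k') (i i' : ℤ) {n : ℕ} (t : Fin n → ℤ) :
    (D.visited L k i t).card + (D.visited L k' i' (-t)).card ≤ n + 2 := by
  classical
  obtain ⟨A, hA, hA1, hA2⟩ := hc.exists_representatives hk i t
  obtain ⟨A', hA', hA1', hA2'⟩ := hc.exists_representatives hk' i' (-t)
  rw [← hA, ← hA', ← Finset.card_union_add_card_inter]
  have h1 : (A ∪ A').card ≤ n := (Finset.card_le_univ _).trans (by simp)
  let p : Fin n → Prop := fun j => ∃ q q', q ≤ k ∧ q' ≤ k' ∧ |i + t j - D.n k q| ≤ L + 1 ∧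
    |i' + (-t) j - D.n k' q'| ≤ L + 1 ∧ D.n k' q' ≤ D.n k q
  have hsum : ∀ {j : Fin n} {a b : ℤ}, |i + t j - a| ≤ L + 1 → |i' + (-t) j - b| ≤ L + 1 →
      |a + b - (i + i')| ≤ 2 * (L + 1) := by
    intro j a b ha hb
    rw [Pi.neg_apply] at hb
    rw [abs_le] at ha hb ⊢
    omega
  -- among the common times, there is at most one at which the first mark is the larger one, and at
  -- most one at which the second is
  have h2 : ((A ∩ A').filter p).card ≤ 1 := by
    rw [Finset.card_le_one]
    intro j hj j' hj'
    obtain ⟨hj, q, q', hq, hq', e1, e2, e3⟩ := Finset.mem_filter.1 hj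
    obtain ⟨hj', r, r', hr, hr', f1, f2, f3⟩ := Finset.mem_filter.1 hj'
    obtain rfl : q = r := hc.mark_unique_of_sum hk hq hr e3 f3 (hsum e1 e2) (hsum f1 f2)
    exact hA2 j (Finset.mem_inter.1 hj).1 j' (Finset.mem_inter.1 hj').1 q hq e1 f1
  have h3 : ((A ∩ A').filter fun j => ¬ p j).card ≤ 1 := by
    rw [Finset.card_le_one]
    intro j hj j' hj'
    obtain ⟨hj, hpj⟩ := Finset.mem_filter.1 hj
    obtain ⟨hj', hpj'⟩ := Finset.mem_filter.1 hj'
    obtain ⟨q, hq, e1⟩ := hA1 j (Finset.mem_inter.1 hj).1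
    obtain ⟨q', hq', e2⟩ := hA1' j (Finset.mem_inter.1 hj).2
    obtain ⟨r, hr, f1⟩ := hA1 j' (Finset.mem_inter.1 hj').1
    obtain ⟨r', hr', f2⟩ := hA1' j' (Finset.mem_inter.1 hj').2
    have e3 : D.n k q ≤ D.n k' q' := by
      by_contra! h
      exact hpj ⟨q, q', hq, hq', e1, e2, h.le⟩
    have f3 : D.n k r ≤ D.n k' r' := by
      by_contra! h
      exact hpj' ⟨r, r', hr, hr', f1, f2, h.le⟩
    have e4 := hsum e1 e2
    have f4 := hsum f1 f2
    rw [add_comm (D.n k q : ℤ)] at e4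
    rw [add_comm (D.n k r : ℤ)] at f4
    obtain rfl : q' = r' := hc.mark_unique_of_sum hk' hq' hr' e3 f3 e4 f4
    exact hA2' j (Finset.mem_inter.1 hj).2 j' (Finset.mem_inter.1 hj').2 q' hq' e2 f2
  have h4 := Finset.card_filter_add_card_filter_not (s := A ∩ A') p
  omega

end IsCoding

end TanYeZhangChoice

namespace TanYeZhangChoice

variable {D : TanYeZhangChoice}

namespace IsCoding

variable {L : ℤ} {K : ℕ} {P₀ : Finset (Word × ℤ)}

/-- The points of `A` and of the orbits of the levels up to `K` have, altogether, only finitely many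
points with a code, so that their patterns are linearly many in the number of times. -/
theorem exists_finset_pattern_low (hc : D.IsCoding L K P₀) :
    ∃ C : ℕ, ∀ (n : ℕ) (t : Fin n → ℤ), ∃ S : Finset (Fin n → Option Pt), S.card ≤ C * (n + 1) ∧
      (∀ z, D.pattern L P₀ t (Sum.inl z) ∈ S) ∧
      ∀ p : Word × ℤ, p.1.level ≤ K → D.pattern L P₀ t (Sum.inr p) ∈ S := by
  classical
  let F : Finset Pt := (Finset.Icc (-L) L).image (fun z : ℤ => Sum.inl (z : OnePoint ℤ)) ∪
    P₀.image Sum.inr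
  refine ⟨F.card + 1, fun n t => ?_⟩
  let S : Finset (Fin n → Option Pt) := insert (fun _ => none)
    (((Finset.univ : Finset (Fin n)) ×ˢ F).image fun x => D.pattern L P₀ t (shift (-t x.1) x.2))
  have key : ∀ q, (∀ j, D.code L P₀ (shift (t j) q) ≠ none → shift (t j) q ∈ F) →
      D.pattern L P₀ t q ∈ S := by
    intro q hq
    by_cases h : ∃ j, D.code L P₀ (shift (t j) q) ≠ none
    · obtain ⟨j, hj⟩ := h
      refine Finset.mem_insert_of_mem (Finset.mem_image.2 ⟨(j, shift (t j) q), ?_, ?_⟩)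
      · exact Finset.mem_product.2 ⟨Finset.mem_univ _, hq j hj⟩
      · simp only
        rw [← shift_add, neg_add_cancel, shift_zero]
    · push Not at h
      exact Finset.mem_insert.2 (Or.inl (funext h))
  refine ⟨S, ?_, fun z => key _ fun j hj => ?_, fun p hp => key _ fun j hj => ?_⟩
  · have h1 : S.card ≤ _ := Finset.card_insert_le _ _
    have h2 := Finset.card_image_le (s := (Finset.univ : Finset (Fin n)) ×ˢ F)
      (f := fun x => D.pattern L P₀ t (shift (-t x.1) x.2))
    rw [Finset.card_product, Finset.card_univ, Fintype.card_fin] at h2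
    nlinarith
  · induction z using OnePoint.rec with
    | infty => exact absurd rfl hj
    | coe z =>
      have hz : |z + t j| ≤ L := by
        by_contra h
        exact hj (if_neg h)
      exact Finset.mem_union_left _
        (Finset.mem_image.2 ⟨z + t j, Finset.mem_Icc.2 (abs_le.1 hz), rfl⟩)
  · refine Finset.mem_union_right _ (Finset.mem_image.2 ⟨(p.1, p.2 + t j), ?_, rfl⟩)
    by_contra h
    refine hj ((if_neg h).trans (if_neg ?_))
    exact not_le.2 (hc.far (p.1, p.2 + t j) hp h)

/-- The patterns of all the points form polynomially many families, each of which is a single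
pattern or is indexed by the letters at the marks visited by one orbit. -/
theorem exists_families (hc : D.IsCoding L K P₀) :
    ∃ C : ℕ, ∀ (n : ℕ) (t : Fin n → ℤ), ∃ I : Finset (Finset (Fin n → Option Pt)),
      I.card ≤ C * (n + 1) ^ 2 ∧ (∀ q, ∃ S ∈ I, D.pattern L P₀ t q ∈ S) ∧
      ∀ S ∈ I, S.card ≤ 1 ∨ ∃ k i, K < k ∧ S.card ≤ 2 ^ (D.visited L k i t).card := by
  classical
  obtain ⟨C, hC⟩ := hc.exists_finset_pattern_low
  let E : Finset ℤ := Finset.Icc (-(L + 1)) (L + 1)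
  refine ⟨C + E.card ^ 2, fun n t => ?_⟩
  obtain ⟨S₀, hS₀, hinl, hlow⟩ := hC n t
  -- an orbit visiting two marks `q₁ < q₂` is recorded by the two times and the deviations from the
  -- marks, from which `φ` recovers its level and its position
  let R : (Fin n × Fin n) × (ℤ × ℤ) → ℕ × ℤ → Prop := fun x y =>
    K < y.1 ∧ ∃ q₁ q₂, q₁ < q₂ ∧ q₂ ≤ y.1 ∧ y.2 + t x.1.1 - D.n y.1 q₁ = x.2.1 ∧
      y.2 + t x.1.2 - D.n y.1 q₂ = x.2.2
  let φ : (Fin n × Fin n) × (ℤ × ℤ) → ℕ × ℤ := fun x => if h : ∃ y, R x y then h.choose else (0, 0)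
  have hφ : ∀ x y, R x y → φ x = y := by
    intro x y h
    have hex : ∃ y, R x y := ⟨y, h⟩
    have h1 : φ x = hex.choose := dif_pos hex
    rw [h1]
    obtain ⟨-, q₁, q₂, h12, h2, e1, e2⟩ := hex.choose_spec
    obtain ⟨-, q₁', q₂', h12', h2', e1', e2'⟩ := h
    exact level_time_unique h12 h2 h12' h2' e1 e2 e1' e2'
  let Q : Finset (ℕ × ℤ) :=
    ((((Finset.univ : Finset (Fin n × Fin n)) ×ˢ (E ×ˢ E)).image φ).filter fun y => K < y.1)
  have hQ : Q.card ≤ n ^ 2 * E.card ^ 2 := by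
    refine (Finset.card_filter_le _ _).trans (Finset.card_image_le.trans ?_)
    rw [Finset.card_product, Finset.card_product, Finset.card_univ, Fintype.card_prod,
      Fintype.card_fin, sq, sq]
  let fam : ℕ × ℤ → Finset (Fin n → Option Pt) := fun y =>
    (D.visited L y.1 y.2 t).powerset.image (D.markPattern L y.1 y.2 t)
  have hfam : ∀ y, (fam y).card ≤ 2 ^ (D.visited L y.1 y.2 t).card := fun y =>
    Finset.card_image_le.trans (Finset.card_powerset _).le
  refine ⟨S₀.image (fun b => {b}) ∪ Q.image fam, ?_, ?_, ?_⟩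
  · have h1 := Finset.card_union_le (S₀.image fun b => ({b} : Finset (Fin n → Option Pt)))
      (Q.image fam)
    have h2 := Finset.card_image_le (s := S₀) (f := fun b => ({b} : Finset (Fin n → Option Pt)))
    have h3 := Finset.card_image_le (s := Q) (f := fam)
    have h4 : C * (n + 1) ≤ C * (n + 1) ^ 2 := Nat.mul_le_mul_left _ (by nlinarith)
    have h5 : n ^ 2 * E.card ^ 2 ≤ E.card ^ 2 * (n + 1) ^ 2 := by
      rw [mul_comm]
      exact Nat.mul_le_mul_left _ (by nlinarith)
    calc _ ≤ C * (n + 1) ^ 2 + E.card ^ 2 * (n + 1) ^ 2 := by omega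
      _ = _ := by ring
  · have hlow' : ∀ b ∈ S₀, ∃ S ∈ S₀.image (fun b => {b}) ∪ Q.image fam, b ∈ S := fun b hb =>
      ⟨{b}, Finset.mem_union_left _ (Finset.mem_image_of_mem _ hb), Finset.mem_singleton_self _⟩
    rintro (z | ⟨w, i⟩)
    · exact hlow' _ (hinl z)
    rcases le_or_gt w.level K with hw | hw
    · exact hlow' _ (hlow (w, i) hw)
    rcases le_or_gt (D.visited L w.level i t).card 1 with hv | hv
    · obtain ⟨z, hz⟩ := hc.exists_pattern_inl hw i t hv
      rw [hz]
      exact hlow' _ (hinl z)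
    · refine ⟨fam (w.level, i), Finset.mem_union_right _ (Finset.mem_image_of_mem _ ?_), ?_⟩
      · have hex : ∃ q₁ ∈ D.visited L w.level i t, ∃ q₂ ∈ D.visited L w.level i t, q₁ < q₂ := by
          obtain ⟨a, ha, b, hb, hab⟩ := Finset.one_lt_card.1 hv
          rcases lt_or_gt_of_ne hab with h | h
          · exact ⟨a, ha, b, hb, h⟩
          · exact ⟨b, hb, a, ha, h⟩
        obtain ⟨q₁, hq₁, q₂, hq₂, h12⟩ := hex
        obtain ⟨h1, j₁, hj₁⟩ := D.mem_visited.1 hq₁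
        obtain ⟨h2, j₂, hj₂⟩ := D.mem_visited.1 hq₂
        refine Finset.mem_filter.2 ⟨Finset.mem_image.2 ⟨((j₁, j₂),
          (i + t j₁ - D.n w.level q₁, i + t j₂ - D.n w.level q₂)), ?_,
          hφ _ _ ⟨hw, q₁, q₂, h12, h2, rfl, rfl⟩⟩, hw⟩
        exact Finset.mem_product.2 ⟨Finset.mem_univ _, Finset.mem_product.2
          ⟨Finset.mem_Icc.2 (abs_le.1 hj₁), Finset.mem_Icc.2 (abs_le.1 hj₂)⟩⟩
      · rw [hc.pattern_eq_markPattern hw i t]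
        exact Finset.mem_image_of_mem _ (Finset.mem_powerset.2 (Finset.filter_subset _ _))
  · intro S hS
    rcases Finset.mem_union.1 hS with h | h
    · obtain ⟨b, -, rfl⟩ := Finset.mem_image.1 h
      exact Or.inl (Finset.card_singleton b).le
    · obtain ⟨y, hy, rfl⟩ := Finset.mem_image.1 h
      exact Or.inr ⟨y.1, y.2, (Finset.mem_filter.1 hy).2, hfam y⟩

/-- The pairs of a pattern seen forwards and a pattern seen backwards are not substantially more
than the patterns seen forwards. -/
theorem exists_card_pattern_pair_le (hc : D.IsCoding L K P₀) :
    ∃ C : ℕ, ∀ (n : ℕ) (t : Fin n → ℤ),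
      (Set.range fun x : Pt × Pt => (D.pattern L P₀ t x.1, D.pattern L P₀ (-t) x.2)).encard ≤
        ((C * (n + 1) ^ 4 * 2 ^ n : ℕ) : ℕ∞) := by
  classical
  obtain ⟨C, hC⟩ := hc.exists_families
  refine ⟨4 * C ^ 2, fun n t => ?_⟩
  obtain ⟨I, hI, hcov, hcard⟩ := hC n t
  obtain ⟨I', hI', hcov', hcard'⟩ := hC n (-t)
  let V := (I ×ˢ I').biUnion fun x => x.1 ×ˢ x.2
  have hsub : (Set.range fun x : Pt × Pt => (D.pattern L P₀ t x.1, D.pattern L P₀ (-t) x.2)) ⊆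
      (V : Set _) := by
    rintro _ ⟨⟨q, q'⟩, rfl⟩
    obtain ⟨S, hS, h⟩ := hcov q
    obtain ⟨S', hS', h'⟩ := hcov' q'
    exact Finset.mem_biUnion.2 ⟨(S, S'), Finset.mem_product.2 ⟨hS, hS'⟩,
      Finset.mem_product.2 ⟨h, h'⟩⟩
  refine (Set.encard_le_encard hsub).trans ?_
  rw [Set.encard_coe_eq_coe_finsetCard]
  norm_cast
  have hprod : ∀ x ∈ I ×ˢ I', (x.1 ×ˢ x.2).card ≤ 2 ^ (n + 2) := by
    rintro ⟨S, S'⟩ hx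
    obtain ⟨hS, hS'⟩ := Finset.mem_product.1 hx
    rw [Finset.card_product]
    have hone : 1 ≤ 2 ^ (n + 2) := Nat.one_le_two_pow
    have hpow : ∀ m, m ≤ n → 2 ^ m ≤ 2 ^ (n + 2) := fun m hm =>
      Nat.pow_le_pow_right (by norm_num) (by omega)
    rcases hcard S hS with h | ⟨k, i, hk, h⟩ <;> rcases hcard' S' hS' with h' | ⟨k', i', hk', h'⟩
    · exact (Nat.mul_le_mul h h').trans hone
    · have := hpow _ (hc.card_visited_le hk' i' (-t))
      exact (Nat.mul_le_mul h h').trans (by omega)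
    · have := hpow _ (hc.card_visited_le hk i t)
      exact (Nat.mul_le_mul h h').trans (by omega)
    · refine (Nat.mul_le_mul h h').trans ?_
      rw [← pow_add]
      exact Nat.pow_le_pow_right (by norm_num)
        (hc.card_visited_add_card_visited_neg_le hk hk' i i' t)
  calc V.card ≤ ∑ x ∈ I ×ˢ I', (x.1 ×ˢ x.2).card := Finset.card_biUnion_le
    _ ≤ (I ×ˢ I').card * 2 ^ (n + 2) := by
        rw [← smul_eq_mul]
        exact Finset.sum_le_card_nsmul _ _ _ hprod
    _ ≤ ((C * (n + 1) ^ 2) * (C * (n + 1) ^ 2)) * 2 ^ (n + 2) := by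
        rw [Finset.card_product]
        exact Nat.mul_le_mul_right _ (Nat.mul_le_mul hI hI')
    _ = 4 * C ^ 2 * (n + 1) ^ 4 * 2 ^ n := by ring

end IsCoding

end TanYeZhangChoice

namespace TanYeZhangChoice

variable {D : TanYeZhangChoice}

/-! ### The entropies of the system and of its co-induced system -/

/-- The disjoint closed sets which the orbits visit in every order. -/
def visitSet (D : TanYeZhangChoice) (b : Fin 2) : Set D.X₁ :=
  {y | (y : Plane) ∈ D.U 1 (((b : ℕ) : ℤ) : OnePoint ℤ)}

theorem isClosed_visitSet (b : Fin 2) : IsClosed (D.visitSet b) :=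
  (D.U_closed 1 le_rfl _).preimage continuous_subtype_val

theorem disjoint_visitSet : Disjoint (D.visitSet 0) (D.visitSet 1) :=
  (D.U_disjoint 1 le_rfl 0 1 (by norm_num)).preimage Subtype.val

/-- At the time `n_q` the orbit of the word `s` is close to the point `a_{s(q)}`. -/
theorem mem_visitSet (k : ℕ) (s : BinWord (k + 1)) (q : Fin (k + 1 + 1)) :
    D.equivX₁ (shift (D.n (k + 1) q) (Sum.inr (⟨k, s⟩, 0))) ∈ D.visitSet (s q) := by
  have hJ := D.jumpsInterlace (k := k + 1) (by simp) s
  have hm : markIndex (D.n (k + 1)) (D.jump (k + 1) s) (D.n (k + 1) q) = q := by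
    refine hJ.markIndex_eq (Nat.lt_succ_iff.1 q.is_lt) (fun r hr => ?_) (fun r hr => ?_)
    · have := (hJ r).2
      rw [hr] at this
      omega
    · have := (hJ r).1
      rw [hr]
      omega
  have ha : D.anchor (⟨k, s⟩, 0 + D.n (k + 1) q) = ((s q : ℕ) : ℤ) := by
    change anchorIndex _ _ _ _ = _
    unfold anchorIndex
    rw [zero_add, hm, ← s.letter_val q]
    ring
  have h := D.pos_mem_U (⟨k, s⟩, 0 + D.n (k + 1) q)
  rw [ha] at h
  exact D.U_level_anti le_rfl (le_trans (by simp) (D.level_le_nearness _)) _ h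

theorem log_two_le_of_exists_zpow {T : D.X₁ ≃ₜ D.X₁} (hT : D.IsShift T) {Y G : Type*}
    [TopologicalSpace Y] [Group G] (β : G →* (Y ≃ₜ Y)) (π : Y → D.X₁) (hπ : Continuous π)
    (hsurj : Function.Surjective π) (h : ∀ t : ℤ, ∃ g, ∀ y, π (β g y) = (T ^ t) (π y)) :
    ((Real.log 2 : ℝ) : EReal) ≤ maxPatternEntropy β := by
  refine log_two_le_maxPatternEntropy β (fun b => π ⁻¹' D.visitSet b)
    (fun b => (isClosed_visitSet b).preimage hπ) (disjoint_visitSet.preimage π) fun k hk => ?_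
  obtain ⟨k, rfl⟩ : ∃ k', k = k' + 1 := ⟨k - 1, by omega⟩
  choose g hg using h
  refine ⟨fun q => g (D.n (k + 1) q), fun s => ?_⟩
  obtain ⟨y, hy⟩ := hsurj (D.equivX₁ (Sum.inr (⟨k, s⟩, 0)))
  refine ⟨y, fun q => ?_⟩
  change π _ ∈ D.visitSet _
  rw [hg, hy, zpow_equivX₁ D hT]
  exact mem_visitSet k s q

/-- An action by the powers of the shift, in which every power occurs, has entropy `log 2`. -/
theorem maxPatternEntropy_eq_of_zpow {T : D.X₁ ≃ₜ D.X₁} (hT : D.IsShift T) {G : Type*} [Group G]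
    (β : G →* (D.X₁ ≃ₜ D.X₁)) (τ : G → ℤ) (hτ : Function.Surjective τ) (hβ : ∀ g, β g = T ^ τ g) :
    maxPatternEntropy β = ((Real.log 2 : ℝ) : EReal) := by
  refine le_antisymm (iSup₂_le fun 𝒰 h𝒰 => ?_)
    (log_two_le_of_exists_zpow hT β id continuous_id Function.surjective_id fun t => ?_)
  · obtain ⟨δ, hδ, hball⟩ := lebesgue_number_lemma_of_metric_sUnion isCompact_univ h𝒰.1 h𝒰.2.ge
    obtain ⟨L, K, P₀, hc, hfine⟩ := D.exists_isCoding hδ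
    obtain ⟨C, hC⟩ := hc.exists_card_pattern_pair_le
    refine maxPatternEntropyOf_le_log_two β 𝒰 C 4 fun n g => ?_
    refine (minSubcoverCard_patternJoin_le β g 𝒰
      (fun y => D.pattern L P₀ (fun i => τ (g i)) (D.equivX₁.symm y)) fun y i => ?_).trans
      (le_trans ?_ (hC n fun i => τ (g i)))
    · obtain ⟨V, hV, hsub⟩ := hball (β (g i) y) (Set.mem_univ _)
      refine ⟨V, hV, fun y' hy' => hsub ?_⟩
      obtain ⟨q, rfl⟩ := D.equivX₁.surjective y
      obtain ⟨q', rfl⟩ := D.equivX₁.surjective y'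
      simp only [Equiv.symm_apply_apply] at hy'
      rw [hβ, zpow_equivX₁ D hT, zpow_equivX₁ D hT]
      exact hfine _ _ (congrFun hy' i)
    · refine le_trans (Set.encard_le_encard ?_) (Set.encard_image_le Prod.fst _)
      rintro _ ⟨y, rfl⟩
      exact ⟨_, ⟨(D.equivX₁.symm y, D.equivX₁.symm y), rfl⟩, rfl⟩
  · obtain ⟨g, hg⟩ := hτ t
    exact ⟨g, fun y => by rw [hβ, hg]; rfl⟩

/-- An action on `X₁ × X₁` by the maps `Tᵗ × T⁻ᵗ`, up to interchanging the coordinates, has entropy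
`log 2` if every power occurs. -/
theorem maxPatternEntropy_eq_of_zpow_neg {T : D.X₁ ≃ₜ D.X₁} (hT : D.IsShift T) {ι G : Type*}
    [Group G] (β : G →* ((ι → D.X₁) ≃ₜ (ι → D.X₁))) (o r : ι) (hor : ∀ θ, θ = o ∨ θ = r)
    (hβ : ∀ g, ∃ t : ℤ, (∀ f, β g f o = (T ^ t) (f o) ∧ β g f r = (T ^ (-t)) (f r)) ∨
      (∀ f, β g f o = (T ^ (-t)) (f r) ∧ β g f r = (T ^ t) (f o)))
    (hβ' : ∀ t : ℤ, ∃ g, ∀ f, β g f o = (T ^ t) (f o)) :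
    maxPatternEntropy β = ((Real.log 2 : ℝ) : EReal) := by
  classical
  have : Fintype ι := ⟨{o, r}, fun θ => by simpa using hor θ⟩
  refine le_antisymm (iSup₂_le fun 𝒰 h𝒰 => ?_)
    (log_two_le_of_exists_zpow hT β (fun f => f o) (continuous_apply o)
      (fun y => ⟨fun _ => y, rfl⟩) hβ')
  obtain ⟨δ, hδ, hball⟩ := lebesgue_number_lemma_of_metric_sUnion isCompact_univ h𝒰.1 h𝒰.2.ge
  obtain ⟨L, K, P₀, hc, hfine⟩ := D.exists_isCoding hδ
  obtain ⟨C, hC⟩ := hc.exists_card_pattern_pair_le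
  choose τ hτ using hβ
  refine maxPatternEntropyOf_le_log_two β 𝒰 C 4 fun n g => ?_
  refine (minSubcoverCard_patternJoin_le β g 𝒰
    (fun f => (D.pattern L P₀ (fun i => τ (g i)) (D.equivX₁.symm (f o)),
      D.pattern L P₀ (-fun i => τ (g i)) (D.equivX₁.symm (f r)))) fun f i => ?_).trans
    (le_trans (Set.encard_le_encard ?_) (hC n fun i => τ (g i)))
  · obtain ⟨V, hV, hsub⟩ := hball (β (g i) f) (Set.mem_univ _)
    refine ⟨V, hV, fun f' hf' => hsub ?_⟩
    obtain ⟨h1, h2⟩ := Prod.mk.inj hf'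
    have key : ∀ (t : ℤ) (y y' : D.X₁),
        D.code L P₀ (shift t (D.equivX₁.symm y')) = D.code L P₀ (shift t (D.equivX₁.symm y)) →
        dist ((T ^ t) y') ((T ^ t) y) < δ := by
      intro t y y' h
      obtain ⟨q, rfl⟩ := D.equivX₁.surjective y
      obtain ⟨q', rfl⟩ := D.equivX₁.surjective y'
      simp only [Equiv.symm_apply_apply] at h
      rw [zpow_equivX₁ D hT, zpow_equivX₁ D hT]
      exact hfine _ _ h
    have k1 := key (τ (g i)) (f o) (f' o) (congrFun h1 i)
    have k2 := key (-τ (g i)) (f r) (f' r) (congrFun h2 i)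
    rw [Metric.mem_ball, dist_pi_lt_iff hδ]
    intro θ
    rcases hτ (g i) with h | h
    · rcases hor θ with rfl | rfl
      · rwa [(h f).1, (h f').1]
      · rwa [(h f).2, (h f').2]
    · rcases hor θ with rfl | rfl
      · rwa [(h f).1, (h f').1]
      · rwa [(h f).2, (h f').2]
  · rintro _ ⟨f, rfl⟩
    exact ⟨(D.equivX₁.symm (f o), D.equivX₁.symm (f r)), rfl⟩

end TanYeZhangChoice

/-! ### The group `ℤ ⋊ ℤ/2ℤ` and co-induction from `ℤ` -/

namespace ZInvZ2

/-- The generator of `ℤ/2ℤ`. -/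
abbrev gen : Multiplicative (ZMod 2) := Multiplicative.ofAdd 1

theorem gen_ne_one : gen ≠ 1 := by decide

theorem eq_one_or_gen : ∀ i : Multiplicative (ZMod 2), i = 1 ∨ i = gen := by decide

theorem inversionHom_gen (x : Multiplicative ℤ) : inversionHom gen x = x⁻¹ := by
  change (if gen = 1 then (1 : MulAut (Multiplicative ℤ)) else MulEquiv.inv _) x = _
  rw [if_neg gen_ne_one]
  rfl

theorem inversionHom_gen_inv (x : Multiplicative ℤ) : (inversionHom gen)⁻¹ x = x⁻¹ := by
  change (inversionHom gen).symm x = _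
  rw [MulEquiv.symm_apply_eq, inversionHom_gen, inv_inv]

theorem intSubgroup_eq_ker :
    intSubgroup = (SemidirectProduct.rightHom : ZInvZ2 →* Multiplicative (ZMod 2)).ker :=
  SemidirectProduct.range_inl_eq_ker_rightHom

theorem mem_intSubgroup_iff {g : ZInvZ2} : g ∈ intSubgroup ↔ g.right = 1 := by
  rw [intSubgroup_eq_ker]
  rfl

theorem index_intSubgroup : intSubgroup.index = 2 := by
  rw [intSubgroup_eq_ker, Subgroup.index_ker,
    MonoidHom.range_eq_top.2 SemidirectProduct.rightHom_surjective, Subgroup.card_top]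
  simp

theorem not_intSubgroup_le_center : ¬ intSubgroup ≤ Subgroup.center ZInvZ2 := by
  intro h
  have h1 := h (x := SemidirectProduct.inl (Multiplicative.ofAdd 1)) ⟨_, rfl⟩
  have h2 := congrArg SemidirectProduct.left
    (Subgroup.mem_center_iff.1 h1 (SemidirectProduct.inr gen))
  simp only [SemidirectProduct.mul_left, SemidirectProduct.left_inl, SemidirectProduct.left_inr,
    SemidirectProduct.right_inl, SemidirectProduct.right_inr, inversionHom_gen, map_one,
    one_mul, mul_one] at h2
  exact absurd h2 (by decide)

theorem intSubgroupAction_apply {X : Type*} [TopologicalSpace X] (T : X ≃ₜ X) (h : intSubgroup) :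
    intSubgroupAction T h = T ^ (Multiplicative.toAdd (h : ZInvZ2).left) := by
  obtain ⟨m, rfl⟩ := intEquiv.surjective h
  change zAction T (intEquiv.symm (intEquiv m)) = _
  rw [MulEquiv.symm_apply_apply]
  rfl

theorem rightCoset_eq_iff {a b : ZInvZ2} :
    rightCoset intSubgroup a = rightCoset intSubgroup b ↔ a.right = b.right := by
  rw [rightCosets_mk_eq_iff, mem_intSubgroup_iff, SemidirectProduct.mul_right,
    SemidirectProduct.inv_right, mul_inv_eq_one]

variable {X : Type*} [TopologicalSpace X] (T : X ≃ₜ X) (s : CosetSection intSubgroup)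

theorem coinduced_apply (g : ZInvZ2) (f : RightCosets intSubgroup → X)
    (θ : RightCosets intSubgroup) :
    coinduced (intSubgroupAction T) s g f θ =
      (T ^ (Multiplicative.toAdd (s.toFun θ * g * (s.toFun (s.shift θ g))⁻¹).left))
        (f (s.shift θ g)) := by
  change intSubgroupAction T (s.cocycle θ g) _ = _
  rw [intSubgroupAction_apply]
  rfl

/-- The two cosets are that of `1` and that of the generator of `ℤ/2ℤ`, and an element of the group
acts on the two coordinates of the co-induced system by inverse powers of `T`, interchanging the
coordinates if it is not in `ℤ`. -/
theorem coinduced_cases (g : ZInvZ2) :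
    ∃ t : ℤ,
      (∀ f : RightCosets intSubgroup → X,
        coinduced (intSubgroupAction T) s g f (rightCoset _ 1) = (T ^ t) (f (rightCoset _ 1)) ∧
        coinduced (intSubgroupAction T) s g f (rightCoset _ (SemidirectProduct.inr gen)) =
          (T ^ (-t)) (f (rightCoset _ (SemidirectProduct.inr gen)))) ∨
      (∀ f : RightCosets intSubgroup → X,
        coinduced (intSubgroupAction T) s g f (rightCoset _ 1) =
          (T ^ (-t)) (f (rightCoset _ (SemidirectProduct.inr gen))) ∧
        coinduced (intSubgroupAction T) s g f (rightCoset _ (SemidirectProduct.inr gen)) =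
          (T ^ t) (f (rightCoset _ 1))) := by
  set o := rightCoset intSubgroup 1 with ho
  set r := rightCoset intSubgroup (SemidirectProduct.inr gen) with hr
  have hso : s.toFun o = 1 := s.toFun_one
  obtain ⟨m, hm⟩ : ∃ m, s.toFun r = ⟨m, gen⟩ := by
    refine ⟨(s.toFun r).left, ?_⟩
    have h : (s.toFun r).right = gen := rightCoset_eq_iff.1 (s.mk_toFun r)
    ext
    · rfl
    · exact h
  obtain ⟨u, ε⟩ := g
  rcases eq_one_or_gen ε with rfl | rfl
  · refine ⟨Multiplicative.toAdd u, Or.inl fun f => ⟨?_, ?_⟩⟩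
    · have hs : s.shift o ⟨u, 1⟩ = o := by
        rw [CosetSection.shift, hso, one_mul, ho, rightCoset_eq_iff]
        rfl
      rw [coinduced_apply, hs, hso]
      refine congrArg (fun a : ℤ => (T ^ a) _) ?_
      simp
    · have hs : s.shift r ⟨u, 1⟩ = r := by
        rw [CosetSection.shift, hm, hr, rightCoset_eq_iff]
        rfl
      rw [coinduced_apply, hs, hm]
      refine congrArg (fun a : ℤ => (T ^ a) _) ?_
      simp only [SemidirectProduct.mul_left, SemidirectProduct.mul_right,
        SemidirectProduct.inv_left, mul_one, inversionHom_gen, inversionHom_gen_inv, map_inv,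
        inv_inv, toAdd_mul, toAdd_inv]
      ring
  · refine ⟨Multiplicative.toAdd m - Multiplicative.toAdd u, Or.inr fun f => ⟨?_, ?_⟩⟩
    · have hs : s.shift o ⟨u, gen⟩ = r := by
        rw [CosetSection.shift, hso, one_mul, hr, rightCoset_eq_iff]
        rfl
      rw [coinduced_apply, hs, hso, hm]
      refine congrArg (fun a : ℤ => (T ^ a) _) ?_
      simp [← sub_eq_add_neg]
    · have hs : s.shift r ⟨u, gen⟩ = o := by
        rw [CosetSection.shift, hm, ho, rightCoset_eq_iff]
        change gen * gen = 1
        decide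
      rw [coinduced_apply, hs, hso, hm]
      refine congrArg (fun a : ℤ => (T ^ a) _) ?_
      simp [inversionHom_gen, sub_eq_add_neg]

end ZInvZ2

namespace TanYeZhangChoice

/-! ### The construction can be carried out -/

namespace Model

/-- An enumeration of `ℤ` by positive numbers, in the order of increasing absolute values. -/
def rank (i : ℤ) : ℕ := if 0 ≤ i then 2 * i.toNat + 1 else 2 * (-i).toNat

theorem rank_pos (i : ℤ) : 1 ≤ rank i := by
  unfold rank
  split_ifs <;> omega

theorem rank_injective : Function.Injective rank := by
  intro i j h
  unfold rank at h
  split_ifs at h <;> omega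

theorem rank_le_of_abs_le {i : ℤ} {m : ℕ} (h : |i| ≤ m) : rank i ≤ 2 * m + 1 := by
  rw [abs_le] at h
  unfold rank
  split_ifs <;> omega

theorem le_rank_of_lt_abs {i : ℤ} {m : ℕ} (h : (m : ℤ) < |i|) : 2 * m + 2 ≤ rank i := by
  rw [lt_abs] at h
  unfold rank
  split_ifs <;> omega

/-- The second coordinate of the point `a_z`. -/
def height (z : OnePoint ℤ) : ℝ := Option.elim z 0 fun i => (1 / 4) ^ rank i

theorem height_infty : height OnePoint.infty = 0 := rfl

theorem height_coe (i : ℤ) : height (i : OnePoint ℤ) = (1 / 4) ^ rank i := rfl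

theorem height_coe_pos (i : ℤ) : 0 < height (i : OnePoint ℤ) := by
  rw [height_coe]
  positivity

theorem height_coe_le (i : ℤ) : height (i : OnePoint ℤ) ≤ 1 / 4 := by
  rw [height_coe]
  calc (1 / 4 : ℝ) ^ rank i ≤ (1 / 4) ^ 1 :=
        pow_le_pow_of_le_one (by norm_num) (by norm_num) (rank_pos i)
    _ = 1 / 4 := by norm_num

theorem height_nonneg (z : OnePoint ℤ) : 0 ≤ height z := by
  induction z using OnePoint.rec with
  | infty => exact le_rfl
  | coe i => exact (height_coe_pos i).le

theorem height_le (z : OnePoint ℤ) : height z ≤ 1 / 4 := by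
  induction z using OnePoint.rec with
  | infty => rw [height_infty]; norm_num
  | coe i => exact height_coe_le i

theorem height_injective : Function.Injective height := by
  intro z z' h
  induction z using OnePoint.rec with
  | infty =>
    induction z' using OnePoint.rec with
    | infty => rfl
    | coe j => exact absurd h (height_coe_pos j).ne
  | coe i =>
    induction z' using OnePoint.rec with
    | infty => exact absurd h (height_coe_pos i).ne'
    | coe j =>
      rw [height_coe, height_coe] at h
      rw [rank_injective (pow_right_injective₀ (by norm_num) (by norm_num) h)]

theorem continuous_height : Continuous height := by
  rw [OnePoint.continuous_iff_from_discrete]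
  have h : Tendsto (fun m : ℕ => (1 / 4 : ℝ) ^ m) atTop (𝓝 0) :=
    tendsto_pow_atTop_nhds_zero_of_lt_one (by norm_num) (by norm_num)
  rw [← Nat.cofinite_eq_atTop] at h
  exact h.comp rank_injective.tendsto_cofinite

/-- The points of `A`, on the unit circle. -/
def a (z : OnePoint ℤ) : Plane := !₂[√(1 - height z ^ 2), height z]

theorem a_zero (z : OnePoint ℤ) : a z 0 = √(1 - height z ^ 2) := rfl

theorem a_one (z : OnePoint ℤ) : a z 1 = height z := rfl

theorem isEmbedding_a : IsEmbedding a := by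
  have hcont : Continuous a := by
    have := continuous_height
    unfold a
    refine (PiLp.continuous_toLp 2 _).comp (continuous_pi fun i => ?_)
    fin_cases i
    · exact Real.continuous_sqrt.comp (by fun_prop)
    · exact this
  exact (hcont.isClosedEmbedding fun z z' h =>
    height_injective (by rw [← a_one, ← a_one, h])).isEmbedding

theorem norm_a (z : OnePoint ℤ) : ‖a z‖ = 1 := by
  have h1 := height_nonneg z
  have h2 := height_le z
  rw [EuclideanSpace.norm_eq, Fin.sum_univ_two, a_zero, a_one, Real.norm_eq_abs, Real.norm_eq_abs,
    sq_abs, sq_abs, Real.sq_sqrt (by nlinarith)]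
  simp

/-- The numbers `n_q^k`. -/
def n (k q : ℕ) : ℕ := if q = 0 then 0 else 9 * 101 ^ (k.choose 2 + q - 1)

theorem n_step {k q : ℕ} (hq : 1 ≤ q) : 100 * n k q < n k (q + 1) := by
  unfold n
  rw [if_neg (by omega), if_neg (by omega)]
  have : k.choose 2 + (q + 1) - 1 = k.choose 2 + q - 1 + 1 := by omega
  rw [this, pow_succ]
  have : 0 < 101 ^ (k.choose 2 + q - 1) := by positivity
  omega

theorem n_next {k : ℕ} (hk : 1 ≤ k) : 100 * n k k < n (k + 1) 1 := by
  unfold n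
  rw [if_neg (by omega), if_neg (by omega)]
  have : (k + 1).choose 2 + 1 - 1 = k.choose 2 + k - 1 + 1 := by
    have := Nat.choose_succ_succ k 1
    rw [Nat.choose_one_right] at this
    simp only [Nat.succ_eq_add_one] at this
    norm_num at this
    omega
  rw [this, pow_succ]
  have : 0 < 101 ^ (k.choose 2 + k - 1) := by positivity
  omega

theorem le_n {k : ℕ} (hk : 1 ≤ k) : k ≤ n k k := by
  unfold n
  rw [if_neg (by omega)]
  have h1 : k < 101 ^ k := Nat.lt_pow_self (by norm_num)
  have h2 : 101 ^ (k - 1) ≤ 101 ^ (k.choose 2 + k - 1) :=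
    Nat.pow_le_pow_right (by norm_num) (by omega)
  have h3 : k - 1 < 101 ^ (k - 1) := Nat.lt_pow_self (by norm_num)
  omega

theorem n_lt (k q : ℕ) : n k q + 2 ≤ n k (q + 1) := by
  rcases Nat.eq_zero_or_pos q with rfl | h
  · have : 0 < 101 ^ (k.choose 2 + 1 - 1) := by positivity
    have e0 : n k 0 = 0 := rfl
    have e1 : n k (0 + 1) = 9 * 101 ^ (k.choose 2 + 1 - 1) := rfl
    omega
  · have h1 := n_step (k := k) h
    have h2 : 1 ≤ n k q := by
      unfold n
      rw [if_neg (by omega)]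
      have : 0 < 101 ^ (k.choose 2 + q - 1) := by positivity
      omega
    omega

theorem n_diag_mono {k : ℕ} (hk : 1 ≤ k) : n k k ≤ n (k + 1) (k + 1) := by
  have h1 := n_next hk
  have h2 : ∀ q, n (k + 1) 1 ≤ n (k + 1) (q + 1) := by
    intro q
    induction q with
    | zero => exact le_rfl
    | succ q ih => exact ih.trans (by have := n_lt (k + 1) (q + 1); omega)
  have := h2 k
  omega

/-- The jump numbers: the jumps take place half-way between the marks. -/
def jump (k : ℕ) (q : Fin k) : ℕ := (n k (q + 1) - n k q) / 2

theorem jumpsInterlace (k : ℕ) : JumpsInterlace (n k) (jump k) := by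
  intro r
  have := n_lt k r
  unfold jump
  omega

/-- Half the side of the square `U^k(a_z)`. -/
def radius (k : ℕ) (z : OnePoint ℤ) : ℝ :=
  Option.elim z ((1 / 4) ^ (2 * n k k + 1) / 2) fun i => (1 / 4) ^ rank i / (4 * k)

theorem radius_infty (k : ℕ) : radius k OnePoint.infty = (1 / 4) ^ (2 * n k k + 1) / 2 := rfl

theorem radius_coe (k : ℕ) (i : ℤ) :
    radius k (i : OnePoint ℤ) = height (i : OnePoint ℤ) / (4 * k) := rfl

theorem radius_pos {k : ℕ} (hk : 1 ≤ k) (z : OnePoint ℤ) : 0 < radius k z := by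
  induction z using OnePoint.rec with
  | infty => rw [radius_infty]; positivity
  | coe i =>
    rw [radius_coe]
    exact div_pos (height_coe_pos i) (by positivity)

theorem radius_coe_le {k : ℕ} (hk : 1 ≤ k) (i : ℤ) :
    radius k (i : OnePoint ℤ) ≤ height (i : OnePoint ℤ) / 4 := by
  have hk' : (1 : ℝ) ≤ k := by exact_mod_cast hk
  rw [radius_coe]
  exact div_le_div_of_nonneg_left (height_nonneg _) (by norm_num) (by linarith)

theorem radius_le {k : ℕ} (hk : 1 ≤ k) (z : OnePoint ℤ) : 4 * radius k z ≤ 1 / k := by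
  have hk' : (1 : ℝ) ≤ k := by exact_mod_cast hk
  induction z using OnePoint.rec with
  | infty =>
    rw [radius_infty]
    have h1 : (k : ℝ) ≤ 16 ^ n k k := by
      have : k ≤ 16 ^ n k k := (le_n hk).trans (Nat.lt_pow_self (by norm_num)).le
      exact_mod_cast this
    have h2 : (1 / 4 : ℝ) ^ (2 * n k k + 1) = 1 / (4 * 16 ^ n k k) := by
      have h4 : ((1 / 4 : ℝ) ^ 2) = 16⁻¹ := by norm_num
      rw [pow_succ, pow_mul, h4, inv_pow]
      field_simp
    rw [h2, show 4 * (1 / (4 * (16 : ℝ) ^ n k k) / 2) = 1 / (2 * 16 ^ n k k) by field_simp]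
    exact one_div_le_one_div_of_le (by linarith) (by linarith)
  | coe i =>
    rw [radius_coe]
    have := height_coe_le i
    rw [show 4 * (height (i : OnePoint ℤ) / (4 * (k : ℝ))) = height (i : OnePoint ℤ) / k by
      field_simp]
    exact div_le_div_of_nonneg_right (by linarith) (by linarith)

theorem radius_anti {k : ℕ} (hk : 1 ≤ k) (z : OnePoint ℤ) : radius (k + 1) z ≤ radius k z := by
  have hk' : (1 : ℝ) ≤ k := by exact_mod_cast hk
  induction z using OnePoint.rec with
  | infty =>
    rw [radius_infty, radius_infty]
    have := n_diag_mono hk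
    exact div_le_div_of_nonneg_right
      (pow_le_pow_of_le_one (by norm_num) (by norm_num) (by omega)) (by norm_num)
  | coe i =>
    rw [radius_coe, radius_coe]
    push_cast
    exact div_le_div_of_nonneg_left (height_nonneg _) (by linarith) (by linarith)

/-- The neighbourhoods `U^k(a_z)`: squares around the points. -/
def U (k : ℕ) (z : OnePoint ℤ) : Set Plane :=
  {p | |p 0 - a z 0| ≤ radius k z ∧ |p 1 - a z 1| ≤ radius k z}

theorem continuous_coord (i : Fin 2) : Continuous fun p : Plane => p i :=
  (EuclideanSpace.proj (𝕜 := ℝ) i).continuous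

theorem isClosed_U (k : ℕ) (z : OnePoint ℤ) : IsClosed (U k z) := by
  have h0 := continuous_coord 0
  have h1 := continuous_coord 1
  exact (isClosed_le (h0.sub continuous_const).abs continuous_const).inter
    (isClosed_le (h1.sub continuous_const).abs continuous_const)

theorem U_mem_nhds {k : ℕ} (hk : 1 ≤ k) (z : OnePoint ℤ) : U k z ∈ 𝓝 (a z) := by
  have key : ∀ i : Fin 2, ∀ᶠ p in 𝓝 (a z), |p i - a z i| ≤ radius k z := fun i =>
    (continuous_coord i).continuousAt (Metric.closedBall_mem_nhds (a z i) (radius_pos hk z))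
  exact (key 0).and (key 1)

theorem U_disjoint {k : ℕ} (hk : 1 ≤ k) {i j : ℤ} (hij : i ≠ j) :
    Disjoint (U k (i : OnePoint ℤ)) (U k (j : OnePoint ℤ)) := by
  have key : ∀ {i j : ℤ} {p : Plane}, p ∈ U k (i : OnePoint ℤ) → p ∈ U k (j : OnePoint ℤ) →
      ¬ rank i < rank j := by
    intro i j p hi hj h
    have h1 := abs_le.1 (hi.2.trans (radius_coe_le hk i))
    have h2 := abs_le.1 (hj.2.trans (radius_coe_le hk j))
    rw [a_one] at h1 h2
    have h3 : height (j : OnePoint ℤ) ≤ height (i : OnePoint ℤ) * (1 / 4) := by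
      rw [height_coe, height_coe, ← pow_succ]
      exact pow_le_pow_of_le_one (by norm_num) (by norm_num) h
    have h4 := height_coe_pos i
    linarith [h1.1, h2.2]
  rw [Set.disjoint_left]
  intro p hi hj
  rcases lt_trichotomy (rank i) (rank j) with h | h | h
  · exact key hi hj h
  · exact hij (rank_injective h)
  · exact key hj hi h

theorem U_disjoint_infty {k : ℕ} (hk : 1 ≤ k) {i : ℤ} (hi : |i| ≤ (n k k : ℤ)) :
    Disjoint (U k (i : OnePoint ℤ)) (U k OnePoint.infty) := by
  rw [Set.disjoint_left]
  intro p h h'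
  have h1 := abs_le.1 (h.2.trans (radius_coe_le hk i))
  have h2 := abs_le.1 h'.2
  rw [a_one] at h1 h2
  rw [height_infty, radius_infty] at h2
  have h3 : (1 / 4 : ℝ) ^ (2 * n k k + 1) ≤ height (i : OnePoint ℤ) :=
    pow_le_pow_of_le_one (by norm_num) (by norm_num) (rank_le_of_abs_le hi)
  have h4 : (0 : ℝ) < (1 / 4) ^ (2 * n k k + 1) := by positivity
  linarith [h1.1, h2.2]

theorem U_subset_infty {k : ℕ} (hk : 1 ≤ k) {i : ℤ} (hi : (n k k : ℤ) < |i|) :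
    U k (i : OnePoint ℤ) ⊆ U k OnePoint.infty := by
  have h3 : height (i : OnePoint ℤ) ≤ (1 / 4) ^ (2 * n k k + 1) * (1 / 4) := by
    rw [height_coe, ← pow_succ]
    exact pow_le_pow_of_le_one (by norm_num) (by norm_num) (le_rank_of_lt_abs hi)
  have h4 : (0 : ℝ) < (1 / 4) ^ (2 * n k k + 1) := by positivity
  have h5 := height_coe_pos i
  have h6 := height_coe_le i
  have h7 : 1 - height (i : OnePoint ℤ) ≤ √(1 - height (i : OnePoint ℤ) ^ 2) :=
    Real.le_sqrt_of_sq_le (by nlinarith)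
  have h8 : √(1 - height (i : OnePoint ℤ) ^ 2) ≤ 1 := Real.sqrt_le_one.2 (by nlinarith)
  intro p h
  have h1 := abs_le.1 (h.1.trans (radius_coe_le hk i))
  have h2 := abs_le.1 (h.2.trans (radius_coe_le hk i))
  rw [a_zero] at h1
  rw [a_one] at h2
  constructor
  · rw [a_zero, height_infty, radius_infty, abs_le,
      show √(1 - (0 : ℝ) ^ 2) = 1 by norm_num]
    constructor <;> linarith [h1.1, h1.2]
  · rw [a_one, height_infty, radius_infty, abs_le]
    constructor <;> linarith [h2.1, h2.2]

theorem U_anti {k : ℕ} (hk : 1 ≤ k) (z : OnePoint ℤ) : U (k + 1) z ⊆ U k z :=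
  fun _ h => ⟨h.1.trans (radius_anti hk z), h.2.trans (radius_anti hk z)⟩

theorem dist_le_of_mem_U {k : ℕ} (hk : 1 ≤ k) {z : OnePoint ℤ} {p p' : Plane} (hp : p ∈ U k z)
    (hp' : p' ∈ U k z) : dist p p' ≤ 1 / k := by
  refine le_trans ?_ (radius_le hk z)
  have hr := radius_pos hk z
  have h0 : |p 0 - p' 0| ≤ 2 * radius k z := by
    have h1 := abs_le.1 hp.1
    have h2 := abs_le.1 hp'.1
    rw [abs_le]
    constructor <;> linarith [h1.1, h1.2, h2.1, h2.2]
  have h1 : |p 1 - p' 1| ≤ 2 * radius k z := by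
    have h1 := abs_le.1 hp.2
    have h2 := abs_le.1 hp'.2
    rw [abs_le]
    constructor <;> linarith [h1.1, h1.2, h2.1, h2.2]
  rw [EuclideanSpace.dist_eq, Fin.sum_univ_two]
  refine Real.sqrt_le_iff.2 ⟨by linarith, ?_⟩
  rw [Real.dist_eq, Real.dist_eq]
  have e0 := abs_nonneg (p 0 - p' 0)
  have e1 := abs_nonneg (p 1 - p' 1)
  nlinarith

/-- The indices of the points `x_{s,i}`, of all levels. -/
abbrev Index : Type := (Σ k : ℕ, BinWord k) × ℤ

/-- The index of the anchor of `x_{s,i}`. -/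
def anchor (p : Index) : ℤ := anchorIndex (n p.1.1) (jump p.1.1) p.1.2 p.2

/-- The point of the unit disc at distance `2⁻ᵐ⁻¹` from the point `a_z`, on the same ray. -/
def inner (m : ℕ) (z : OnePoint ℤ) : Plane := (1 - (1 / 2 : ℝ) ^ (m + 1)) • a z

theorem norm_inner (m : ℕ) (z : OnePoint ℤ) : ‖inner m z‖ = 1 - (1 / 2 : ℝ) ^ (m + 1) := by
  have : (1 / 2 : ℝ) ^ (m + 1) ≤ 1 := pow_le_one₀ (by norm_num) (by norm_num)
  rw [inner, norm_smul, norm_a, mul_one, Real.norm_of_nonneg (by linarith)]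

theorem tendsto_inner (z : OnePoint ℤ) : Tendsto (fun m => inner m z) atTop (𝓝 (a z)) := by
  have h : Tendsto (fun m : ℕ => (1 / 2 : ℝ) ^ (m + 1)) atTop (𝓝 0) :=
    (tendsto_pow_atTop_nhds_zero_of_lt_one (by norm_num) (by norm_num)).comp
      (tendsto_add_atTop_nat 1)
  have h2 : Tendsto (fun m : ℕ => (1 - (1 / 2 : ℝ) ^ (m + 1)) • a z) atTop
      (𝓝 ((1 - (0 : ℝ)) • a z)) := (tendsto_const_nhds.sub h).smul_const _
  rwa [sub_zero, one_smul] at h2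

/-- The points can be chosen with different norms, all of them less than `1`, and so different from
one another and from the points of `A`. -/
theorem exists_points : ∃ x : Index → Plane, Function.Injective x ∧
    (∀ p, x p ∉ Set.range a) ∧
    ∀ p, 1 ≤ p.1.1 → x p ∈ U (anchorLevel p.1.1 (n p.1.1) p.2) (anchor p : OnePoint ℤ) := by
  have h : ∀ p : Index, ∃ M : ℕ, 1 ≤ p.1.1 → ∀ m, M ≤ m →
      inner m (anchor p : OnePoint ℤ) ∈
        U (anchorLevel p.1.1 (n p.1.1) p.2) (anchor p : OnePoint ℤ) := by
    intro p
    by_cases hp : 1 ≤ p.1.1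
    · have hl : 1 ≤ anchorLevel p.1.1 (n p.1.1) p.2 := by
        unfold anchorLevel
        omega
      obtain ⟨M, hM⟩ := eventually_atTop.1
        ((tendsto_inner (anchor p : OnePoint ℤ)).eventually (U_mem_nhds hl _))
      exact ⟨M, fun _ => hM⟩
    · exact ⟨0, fun h => absurd h hp⟩
  choose M hM using h
  obtain ⟨e, he⟩ := exists_injective_nat Index
  refine ⟨fun p => inner (Nat.pair (e p) (M p)) (anchor p : OnePoint ℤ), ?_, ?_, ?_⟩
  · intro p p' hpp
    have h1 := congrArg norm hpp
    simp only [norm_inner] at h1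
    have h2 := pow_right_injective₀ (a := (1 / 2 : ℝ)) (by norm_num) (by norm_num)
      (sub_right_injective h1)
    exact he (Nat.pair_eq_pair.1 (Nat.succ_injective h2)).1
  · rintro p ⟨z, hz⟩
    have h1 := congrArg norm hz
    rw [norm_a, norm_inner] at h1
    have : (0 : ℝ) < (1 / 2) ^ (Nat.pair (e p) (M p) + 1) := by positivity
    linarith
  · exact fun p hp => hM p hp _ (Nat.right_le_pair _ _)

theorem nonempty_tanYeZhangChoice : Nonempty TanYeZhangChoice := by
  obtain ⟨x, hinj, hxA, hxU⟩ := exists_points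
  have hU : ∀ k, 1 ≤ k → ∀ (s : BinWord k) (u : ℤ), x (⟨k, s⟩, u) ∈
      U (anchorLevel k (n k) u) (anchorIndex (n k) (jump k) s u : OnePoint ℤ) :=
    fun k hk s u => hxU (⟨k, s⟩, u) hk
  have hmono : ∀ {k : ℕ} (q : Fin k), n k (q + 1) ≤ n k k := fun {k} q =>
    (jumpsInterlace k).mono q.is_lt le_rfl
  have hlev : ∀ {k : ℕ} {u : ℤ}, 0 ≤ u → u ≤ n k k → anchorLevel k (n k) u = k := by
    intro k u h h'
    unfold anchorLevel
    omega
  refine ⟨{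
    a := a
    a_embedding := isEmbedding_a
    a_circle := fun z => by rw [mem_sphere_zero_iff_norm, norm_a]
    n := n
    n_zero := fun k _ => rfl
    n_one_one := by simp [n]
    n_step := fun k _ q hq _ => n_step hq
    n_next := fun k hk => n_next hk
    U := U
    U_closed := fun k _ z => isClosed_U k z
    U_nhds := fun k hk z => U_mem_nhds hk z
    U_disjoint := fun k hk i j hij => U_disjoint hk hij
    U_disjoint_infty := fun k hk i hi => U_disjoint_infty hk hi
    U_subset_infty := fun k hk i hi => U_subset_infty hk hi
    U_anti := fun k hk z => U_anti hk z
    U_diam := fun k hk z p hp p' hp' => dist_le_of_mem_U hk hp hp'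
    jump := fun k _ q => jump k q
    jump_near := ?_
    x := fun k s u => x (⟨k, s⟩, u)
    x_before := ?_
    x_after := ?_
    x_forward := ?_
    x_backward := ?_
    x_injective := ?_
    x_not_mem := fun k _ s i => hxA _
    x_disjoint := ?_ }⟩
  · intro k hk s q
    have h1 := n_lt k q
    have h2 : (2 * jump k q : ℤ) ≤ n k (q + 1) - n k q ∧
        (n k (q + 1) - n k q : ℤ) ≤ 2 * jump k q + 1 := by
      unfold jump
      omega
    have h3 : (2 * jump k q : ℝ) ≤ n k (q + 1) - n k q := by exact_mod_cast h2.1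
    have h4 : (n k (q + 1) - n k q : ℝ) ≤ 2 * jump k q + 1 := by exact_mod_cast h2.2
    have hk' : (1 : ℝ) ≤ k := by exact_mod_cast hk
    rw [abs_le]
    constructor <;> linarith
  · intro k hk s q i hi
    have h1 := (jumpsInterlace k q).2
    have h2 := hmono q
    have h := hU k hk s ((n k q : ℤ) + i)
    rwa [(jumpsInterlace k).anchorIndex_before s q hi, hlev (by omega) (by omega)] at h
  · intro k hk s q i hi
    have h2 := hmono q
    have h := hU k hk s ((n k q : ℤ) + jump k q + i)
    rwa [(jumpsInterlace k).anchorIndex_after s q hi, hlev (by omega) (by omega)] at h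
  · intro k hk s r hr
    have h := hU k hk s ((n k k : ℤ) + r)
    have hl : anchorLevel k (n k) ((n k k : ℤ) + r) = k + r := by
      unfold anchorLevel
      omega
    rwa [(jumpsInterlace k).anchorIndex_forward, hl] at h
  · intro k hk s r hr
    have h := hU k hk s (-(r : ℤ))
    have hl : anchorLevel k (n k) (-(r : ℤ)) = k + r := by
      unfold anchorLevel
      omega
    rwa [(jumpsInterlace k).anchorIndex_backward rfl, hl] at h
  · intro k hk s i j hij
    exact congrArg Prod.snd (hinj hij)
  · intro w w' _ _ hww
    rw [Set.disjoint_left]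
    rintro _ ⟨i, rfl⟩ ⟨j, hj⟩
    exact hww (congrArg Prod.fst (hinj hj)).symm

end Model

end TanYeZhangChoice

end

theorem theorem3p11 :
    -- the construction can be carried out
    Nonempty TanYeZhangChoice ∧
    -- the subgroup ℤ has index 2 and is not central
    ZInvZ2.intSubgroup.index = 2 ∧
    ¬ ZInvZ2.intSubgroup ≤ Subgroup.center ZInvZ2 ∧
    -- every outcome of the construction is a system with the asserted entropies
    ∀ D : TanYeZhangChoice,
      IsCompact D.X₁ ∧
      Set.range D.a ⊆ D.X₁ ∧
      (∃! T : D.X₁ ≃ₜ D.X₁, D.IsShift T) ∧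
      ∀ T : D.X₁ ≃ₜ D.X₁, D.IsShift T →
        maxPatternEntropy (zAction T) = ((Real.log 2 : ℝ) : EReal) ∧
        ∀ s : CosetSection ZInvZ2.intSubgroup,
          maxPatternEntropy (coinduced (intSubgroupAction T) s) = ((Real.log 2 : ℝ) : EReal) ∧
          maxPatternEntropy (coinduced (intSubgroupAction T) s) ≠
            (ZInvZ2.intSubgroup.index : EReal) * maxPatternEntropy (intSubgroupAction T) := by
  refine ⟨TanYeZhangChoice.Model.nonempty_tanYeZhangChoice, ZInvZ2.index_intSubgroup,
    ZInvZ2.not_intSubgroup_le_center, fun D =>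
    ⟨D.isCompact_X₁, D.range_a_subset, D.existsUnique_isShift, fun T hT => ⟨?_, fun s => ?_⟩⟩⟩
  · exact TanYeZhangChoice.maxPatternEntropy_eq_of_zpow hT (zAction T) Multiplicative.toAdd
      Multiplicative.toAdd.surjective fun _ => rfl
  · have hco : maxPatternEntropy (coinduced (intSubgroupAction T) s)
        = ((Real.log 2 : ℝ) : EReal) := by
      refine TanYeZhangChoice.maxPatternEntropy_eq_of_zpow_neg hT _ (rightCoset _ 1)
        (rightCoset _ (SemidirectProduct.inr ZInvZ2.gen)) (fun θ => ?_)
        (ZInvZ2.coinduced_cases T s) fun t => ?_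
      · induction θ using Quotient.inductionOn with
        | h g =>
          exact (ZInvZ2.eq_one_or_gen g.right).imp (fun h => ZInvZ2.rightCoset_eq_iff.2 h)
            fun h => ZInvZ2.rightCoset_eq_iff.2 h
      · refine ⟨SemidirectProduct.inl (Multiplicative.ofAdd t), fun f => ?_⟩
        have hs : s.shift (rightCoset _ 1) (SemidirectProduct.inl (Multiplicative.ofAdd t)) =
            rightCoset _ 1 := by
          rw [CosetSection.shift, s.toFun_one, one_mul, ZInvZ2.rightCoset_eq_iff]
          rfl
        rw [ZInvZ2.coinduced_apply, hs, s.toFun_one]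
        simp
    have hint : maxPatternEntropy (intSubgroupAction T) = ((Real.log 2 : ℝ) : EReal) :=
      TanYeZhangChoice.maxPatternEntropy_eq_of_zpow hT _
        (fun h => Multiplicative.toAdd (h : ZInvZ2).left)
        (fun t => ⟨ZInvZ2.intEquiv (Multiplicative.ofAdd t), rfl⟩)
        (ZInvZ2.intSubgroupAction_apply T)
    refine ⟨hco, ?_⟩
    rw [hco, hint, ZInvZ2.index_intSubgroup]
    have hlog := Real.log_pos one_lt_two
    intro h
    have htwo : ((2 : ℕ) : EReal) = ((2 : ℝ) : EReal) := rfl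
    rw [htwo, ← EReal.coe_mul, EReal.coe_eq_coe_iff] at h
    linarith
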